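/- **Theorem.** Let $p\neq 2$ be a prime, $q=p^v$, and let $\mathbb F_q$ be the field with $q$ elements. For integers $i,j,k\ge 0$ with $i+j+k=q+1$ let $A^S_{i,j,k}$ be the number of homogeneous quartic polynomials $f_4(x,y)\in\mathbb F_q[x,y]$ which have four distinct roots in $\mathbb P^1(\overline{\mathbb F}_q)$, exactly $i$ of them $\mathbb F_q$-rational, and for which the curve $w^2=f_4(x,y)$ (with $x,y$ of weight $1$ and $w$ of weight $2$) has exactly $i+2j$ $\mathbb F_q$-rational points. Put $$\mathrm{QR}^S_{C_{1,4}}(X,Y,Z)=\sum_{\substack{i,j,k\ge 0\\ i+j+k=q+1}}A^S_{i,j,k}\,X^iY^jZ^k .$$ For $t\in\mathbb Z$ let $$N_A(t)=\sum_{\substack{E/\mathbb F_q\\ \#E(\mathbb F_q)=q+1-t}}\frac1{|\mathrm{Aut}_{\mathbb F_q}(E)|},\qquad N_{A,2\times 2}(t)=\sum_{\substack{E/\mathbb F_q,\ \#E(\mathbb F_q)=q+1-t\\ E(\mathbb F_q)[2]\cong \mathbb Z/2\mathbb Z\times\mathbb Z/2\mathbb Z}}\frac1{|\mathrm{Aut}_{\mathbb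 F_q}(E)|},$$ where $E$ runs over the $\mathbb F_q$-isomorphism classes of elliptic curves over $\mathbb F_q$. Then $\mathrm{QR}^S_{C_{1,4}}(X,Y,Z)$ is equal to $(q-1)^2q(q+1)$ times $$\sum_{\substack{t^2\le 4q\\ t\equiv 1\ (\mathrm{mod}\ 2)}}N_A(t)\,X\,Y^{\frac{q-t}2}Z^{\frac{q+t}2}$$ $$+\sum_{\substack{t^2\le 4q\\ t\equiv 0\ (\mathrm{mod}\ 2)}}\Bigl(\bigl(N_A(t)-N_{A,2\times2}(t)\bigr)\Bigl(\tfrac12X^2Y^{\frac{q-1-t}2}Z^{\frac{q-1+t}2}+\tfrac12Y^{\frac{q+1-t}2}Z^{\frac{q+1+t}2}\Bigr)$$ $$\qquad\qquad+N_{A,2\times2}(t)\Bigl(\tfrac14X^4Y^{\frac{q-3-t}2}Z^{\frac{q-3+t}2}+\tfrac34Y^{\frac{q+1-t}2}Z^{\frac{q+1+t}2}\Bigr)\Bigr).$$ (A term whose coefficient is zero is read as zero, even if one of its exponents is negative.) -/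

import Mathlib

namespace QRW

section Quartics

variable (F : Type*) [Field F]

/-- Homogeneous quartic polynomials `f(x, y)` in two variables over `F` (the zero form included). -/
abbrev Quartic : Type _ := MvPolynomial.homogeneousSubmodule (Fin 2) F 4

variable {F}

/-- The roots of `f` on the projective line over an extension `K` of `F`. As `f` is homogeneous,
its vanishing does not depend on the representative of the point. -/
def Quartic.roots (f : Quartic F) (K : Type*) [Field K] [Algebra F K] :
    Set (Projectivization K (Fin 2 → K)) :=
  {P | MvPolynomial.aeval P.rep (f : MvPolynomial (Fin 2) F) = 0}

/-- `f` has four distinct roots on the projective line over the algebraic closure of `F`. -/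
def Quartic.HasDistinctRoots (f : Quartic F) : Prop :=
  (f.roots (AlgebraicClosure F)).ncard = 4

/-- The `F`-rational points of the curve `w² = f(x, y)`, with `(x, y)` homogeneous coordinates on
the projective line and `w` of weight two: `(x, y, w)` and `(c x, c y, c² w)` are the same point
for `c ≠ 0`, so each point is written in exactly one way with `(x, y)` equal to the chosen
representative of a point of the projective line. -/
def Quartic.curvePoints (f : Quartic F) : Set (Projectivization F (Fin 2 → F) × F) :=
  {Q | Q.2 ^ 2 = MvPolynomial.eval Q.1.rep (f : MvPolynomial (Fin 2) F)}

variable (F)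

/-- The number of quartics with distinct roots over the algebraic closure that have exactly `i`
rational roots and for which `w² = f(x, y)` has exactly `i + 2 j` rational points. -/
noncomputable def smoothCount (i j : ℕ) : ℕ :=
  {f : Quartic F | f.HasDistinctRoots ∧ (f.roots F).ncard = i ∧
    f.curvePoints.ncard = i + 2 * j}.ncard

/-- The contribution of the quartics with distinct roots to the quadratic residue weight
enumerator: the sum of `A_{i,j,k} X^i Y^j Z^k` over all `i, j, k ≥ 0` with `i + j + k = q + 1`.
The variables `X, Y, Z` are `X 0, X 1, X 2`. -/
noncomputable def smoothQR [Fintype F] : MvPolynomial (Fin 3) ℚ :=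
  ∑ e ∈ Finset.Nat.antidiagonalTuple 3 (Fintype.card F + 1),
    MvPolynomial.C (smoothCount F (e 0) (e 1) : ℚ) * MvPolynomial.X 0 ^ (e 0) *
      MvPolynomial.X 1 ^ (e 1) * MvPolynomial.X 2 ^ (e 2)

end Quartics

section EllipticCurves

variable (F : Type*) [Field F]

/-- Elliptic curves over `F`, as nonsingular Weierstrass curves. -/
abbrev EllipticCurve : Type _ := {W : WeierstrassCurve F // W.IsElliptic}

/-- Two elliptic curves are isomorphic over `F` if and only if an admissible linear change of
variables `(x, y) ↦ (u² x + r, u³ y + u² s x + t)` over `F` takes one to the other. -/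
instance isoSetoid : Setoid (EllipticCurve F) :=
  (MulAction.orbitRel (WeierstrassCurve.VariableChange F) (WeierstrassCurve F)).comap Subtype.val

/-- The `F`-isomorphism classes of elliptic curves over `F`. -/
abbrev IsoClass : Type _ := Quotient (isoSetoid F)

instance finite_weierstrassCurve [Finite F] : Finite (WeierstrassCurve F) :=
  Finite.of_injective (fun W : WeierstrassCurve F => (W.a₁, W.a₂, W.a₃, W.a₄, W.a₆)) <| by
    rintro ⟨_, _, _, _, _⟩ ⟨_, _, _, _, _⟩ h
    simpa using h

noncomputable instance [Finite F] : Fintype (IsoClass F) := Fintype.ofFinite _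

variable {F}

/-- The group of automorphisms of `E` that are defined over `F` (and fix the identity element):
the admissible changes of variables that take the equation of `E` to itself. -/
abbrev EllipticCurve.Aut (E : EllipticCurve F) : Type _ :=
  MulAction.stabilizer (WeierstrassCurve.VariableChange F) E.1

/-- The group `E(F)` of rational points. -/
abbrev EllipticCurve.Points (E : EllipticCurve F) : Type _ := E.1.toAffine.Point

/-- `E(F)[2] ≅ ℤ/2ℤ × ℤ/2ℤ`. -/
def EllipticCurve.HasFullTwoTorsion [DecidableEq F] (E : EllipticCurve F) : Prop :=
  Nonempty (AddSubgroup.torsionBy E.Points (2 : ℤ) ≃+ ZMod 2 × ZMod 2)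

variable (F)

open Classical in
/-- `N_A(t)`: the number of isomorphism classes of elliptic curves over `F` with `q + 1 - t`
rational points, the class of `E` being counted with weight `1 / |Aut(E)|`. -/
noncomputable def weightedCount [Fintype F] (t : ℤ) : ℚ :=
  ∑ c : IsoClass F with (Nat.card c.out.Points : ℤ) = Fintype.card F + 1 - t,
    1 / (Nat.card c.out.Aut : ℚ)

open Classical in
/-- `N_{A,2×2}(t)`: the same weighted count, restricted to the curves with
`E(F)[2] ≅ ℤ/2ℤ × ℤ/2ℤ`. -/
noncomputable def weightedCountFull [Fintype F] [DecidableEq F] (t : ℤ) : ℚ :=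
  ∑ c : IsoClass F with (Nat.card c.out.Points : ℤ) = Fintype.card F + 1 - t ∧
      c.out.HasFullTwoTorsion,
    1 / (Nat.card c.out.Aut : ℚ)

end EllipticCurves

/-- The integers `t` with `t² ≤ 4 q`. -/
noncomputable def traces (q : ℕ) : Finset ℤ :=
  {t ∈ Finset.Icc (-(2 * q : ℤ)) (2 * q) | t ^ 2 ≤ 4 * q}

theorem mem_traces {q : ℕ} {t : ℤ} : t ∈ traces q ↔ t ^ 2 ≤ 4 * q := by
  have hq : (0 : ℤ) ≤ q := Int.natCast_nonneg q
  simp only [traces, Finset.mem_filter, Finset.mem_Icc, and_iff_right_iff_imp]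
  intro h
  have h0 : (q : ℤ) = 0 ∨ (1 : ℤ) ≤ q := by omega
  rcases h0 with h0 | h0
  · have : t ^ 2 = 0 := le_antisymm (by simpa [h0] using h) (sq_nonneg t)
    have : t = 0 := by simpa using this
    omega
  · constructor <;> nlinarith

/-- The monomial `X^i Y^j Z^k` with integer exponents. A negative exponent is read as `0`; this is
only ever met with a zero coefficient. -/
noncomputable def mono (i j k : ℤ) : MvPolynomial (Fin 3) ℚ :=
  MvPolynomial.X 0 ^ i.toNat * MvPolynomial.X 1 ^ j.toNat * MvPolynomial.X 2 ^ k.toNat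

end QRW

/-!
Write `q` for the number of elements of the field, which is odd. The curve `w² = f(x, y)` of a
quartic form `f` with distinct roots has genus one, and the proof counts the forms for which it has
`n + 1` rational points, `i` of them with `w = 0`, in terms of Weierstrass equations of elliptic
curves.

Substitutions by invertible matrices permute such forms and act transitively on the projective
line. Hence (`sum_projSum`) it is enough to study a form over the point at infinity of the line:
the sum over the forms of the number of points of their curves, which is `n + 1` times the number
of forms, is `q + 1` times the sum over the forms of the number of points at infinity. There are
two kinds of forms with points at infinity. Those that vanish there have a cubic polynomial
`f(x, 1)`, so `w² = f(x, 1)` is a Weierstrass equation after completing the square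
(`cubicFormEquiv`). Those with a nonzero square as leading coefficient can be scaled to be monic,
and a monic form is the same as an elliptic curve with a second marked point: the slopes of the
lines through this point parametrize the quotient of the curve by an involution (`monicFormEquiv`,
`sqCount_psi_eq_of_a₆_eq_zero`), and the marked point can be any affine rational point
(`translationEquiv`). Adding up, the number of forms is `(q² - 1) / q²` times the number of
Weierstrass equations of elliptic curves with `n` affine points (`card_forms`). The same argument
with rational roots in place of rational points shows that `i` times the number of forms with
`i ≥ 1` rational roots is `(q² - 1) / q²` times the number of equations with `i - 1` rational
points of order two (`card_forms_roots`). As there are zero, one or three points of order two, this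
determines all numbers, `i = 0` being what remains. Orbit counting for admissible changes of
variables turns numbers of equations into the weighted numbers of isomorphism classes
(`weightedCount_mul`, `weightedCountFull_mul`).

The sum in the theorem is over `t² ≤ 4 q`, so Hasse's bound is needed (`sq_sub_sqCount_le`). It is
proved by Manin's elementary method. For a curve `y² = g(x)` with cubic `g`, the twist by `g` over
the rational function field has the points `P = (g X, g²)` and `Fr = (g X^q, g^((q + 3) / 2))`. Let
`d(n)` be the degree of the numerator of the `x`-coordinate of `Fr + n P`, divided by `g`. The
formula for the `x`-coordinates of the sum and the difference of two points, with Gauss's lemma to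
see that nothing cancels, gives `d(n + 1) + d(n - 1) = 2 d(n) + 2`. Since `d(0) = q` and `d(-1)` is
the number of points of the curve, `d(n) = n² + t n + q`, and a quadratic polynomial without
negative values at the integers satisfies `t² ≤ 4 q`. The same bound shows that every curve
`w² = f(x, y)` has a rational point: otherwise its quadratic twist would have `2 q + 2` of them.
-/

/-! ### The `x`-coordinates of `P + Q` and `P - Q` -/

namespace WeierstrassCurve.Affine.Point

variable {K : Type*} [Field K] [DecidableEq K] {W : WeierstrassCurve K}

/-- The case `P = Q` of `sym2x_add_sub`, which is the duplication formula. -/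
theorem sym2x_self (h₁ : W.a₁ = 0) (h₃ : W.a₃ = 0) (P : W.toAffine.Point) :
    ∃ k : K, k ≠ 0 ∧ ∀ i, (W.addSubMap i).eval (sym2x P P) = k * sym2x (P + P) 0 i := by
  rcases P with _ | ⟨x, y, hP⟩
  · refine ⟨1, one_ne_zero, fun i => ?_⟩
    simp only [← zero_def, add_zero, sym2x_zero_zero]
    fin_cases i <;> simp [addSubMap]
  have eP := hP.1
  have nP := ((nonsingular_iff ..).1 hP).2
  simp only [equation_iff, h₁, h₃] at eP nP
  by_cases hy : y = W.toAffine.negY x y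
  · rw [add_self_of_Y_eq hy, sym2x_zero_zero]
    have h2 : 2 * y = 0 := by
      rw [negY, h₁, h₃] at hy
      linear_combination hy
    have hd : 3 * x ^ 2 + 2 * W.a₂ * x + W.a₄ ≠ 0 := by
      rcases nP with h | h
      · intro h0
        exact h (by linear_combination -h0)
      · exact absurd (by linear_combination h2) h
    refine ⟨_, pow_ne_zero 2 hd, fun i => ?_⟩
    fin_cases i
    · simp [addSubMap, h₁, h₃, b₂, b₄, b₆, b₈]
      linear_combination (4 * W.a₂ + 8 * x) * eP - (4 * x + 2 * W.a₂) * y * h2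
    · simp [addSubMap, h₁, h₃, b₂, b₄, b₆, b₈]
      linear_combination 2 * y * h2 - 4 * eP
    · simp [addSubMap, h₁, h₃, b₂, b₄, b₆, b₈]
      ring
  · have h2 : 2 * y ≠ 0 := by
      rw [negY, h₁, h₃] at hy
      exact fun h => hy (by linear_combination h)
    have hs : W.toAffine.slope x x y y = (3 * x ^ 2 + 2 * W.a₂ * x + W.a₄) / (2 * y) := by
      rw [slope_of_Y_ne rfl hy, negY, h₁, h₃]
      congr 1 <;> ring
    refine ⟨(2 * y) ^ 2, pow_ne_zero _ h2, fun i => ?_⟩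
    rw [add_self_of_Y_ne hy, sym2x_some_zero, sym2x_some_some, addX, hs, h₁]
    fin_cases i
    · simp [addSubMap, h₁, h₃, b₂, b₄, b₆, b₈, mul_sub, ← mul_pow, mul_div_cancel₀ _ h2]
      linear_combination (4 * W.a₂ + 8 * x) * eP
    · simp [addSubMap, h₁, h₃, b₂, b₄, b₆, b₈]
      linear_combination - 4 * eP
    · simp [addSubMap, h₁, h₃, b₂, b₄, b₆, b₈]
      ring

/-- On a curve `y² = x³ + a₂ x² + a₄ x + a₆`, the symmetric functions of the `x`-coordinates of
`P + Q` and `P - Q` are, projectively, the polynomials `addSubMap` in those of `P` and `Q`. -/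
theorem sym2x_add_sub (h₁ : W.a₁ = 0) (h₃ : W.a₃ = 0) (P Q : W.toAffine.Point) :
    ∃ k : K, k ≠ 0 ∧ ∀ i, (W.addSubMap i).eval (sym2x P Q) = k * sym2x (P + Q) (P - Q) i := by
  rcases eq_or_ne P Q with rfl | hPQ
  · rw [sub_self]
    exact sym2x_self h₁ h₃ P
  rcases eq_or_ne P (-Q) with rfl | hPQ'
  · rw [neg_add_cancel, sym2x_neg_left, sym2x_comm 0, ← neg_add', ← sym2x_neg_left (-(Q + Q)),
      neg_neg]
    exact sym2x_self h₁ h₃ Q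
  rcases P with _ | ⟨x, y, hP⟩
  · refine ⟨1, one_ne_zero, fun i => ?_⟩
    rw [← zero_def, zero_add, zero_sub, sym2x_neg_right]
    rcases Q with _ | ⟨X, Y, hQ⟩
    · exact absurd rfl hPQ
    · rw [sym2x_zero_some, sym2x_some_some]
      fin_cases i <;> simp [addSubMap] <;> ring
  rcases Q with _ | ⟨X, Y, hQ⟩
  · refine ⟨1, one_ne_zero, fun i => ?_⟩
    rw [← zero_def, add_zero, sub_zero, sym2x_some_zero, sym2x_some_some]
    fin_cases i <;> simp [addSubMap] <;> ring
  have hX : x ≠ X := by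
    intro hX
    rcases X_eq_iff.1 hX with h | h
    exacts [hPQ h, hPQ' h]
  have hX' := sub_ne_zero.2 hX
  refine ⟨(x - X) ^ 2, pow_ne_zero _ hX', ?_⟩
  have eP := hP.1
  have eQ := hQ.1
  rw [equation_iff, h₁, h₃] at eP eQ
  have eP' : y ^ 2 = x ^ 3 + W.a₂ * x ^ 2 + W.a₄ * x + W.a₆ := by linear_combination eP
  have eQ' : Y ^ 2 = X ^ 3 + W.a₂ * X ^ 2 + W.a₄ * X + W.a₆ := by linear_combination eQ
  rw [sub_eq_add_neg (some x y hP), neg_some, add_of_X_ne hX, add_of_X_ne hX, sym2x_some_some,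
    sym2x_some_some, slope_of_X_ne hX, slope_of_X_ne hX]
  intro i
  fin_cases i
  · simp [addSubMap, addX, negY, h₁, h₃, b₂, b₄, b₆, b₈]
    field_simp
    linear_combination (norm := skip) (y ^ 2 - Y ^ 2 + (x ^ 3 + W.a₂ * x ^ 2 + W.a₄ * x + W.a₆) -
        (X ^ 3 + W.a₂ * X ^ 2 + W.a₄ * X + W.a₆)) * (eQ' - eP') +
        2 * (W.a₂ + x + X) * (x - X) ^ 2 * (eP' + eQ')
    ring_nf
  · simp [addSubMap, addX, negY, h₁, h₃, b₂, b₄, b₆, b₈]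
    field_simp
    linear_combination (-2) * eP' - 2 * eQ'
  · simp [addSubMap, addX, negY, h₁, h₃, b₂, b₄, b₆, b₈]
    ring

end WeierstrassCurve.Affine.Point

namespace QRW

section

open Polynomial

/-! ### Sums and differences in lowest terms -/

section Unimodular

variable {R : Type*} [CommRing R]

/-- The coefficients of the product of the binary linear forms with coefficients `(A, B)` and
`(A', B')`. -/
def symProd (A B A' B' : R) : Fin 3 → R := ![A * A', A * B' + B * A', B * B']

/-- Gauss's lemma: the product of two primitive linear forms is primitive. Primitivity is
expressed by prime ideals, to pass through the polynomials `addSubMap` below. -/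
theorem exists_symProd_notMem {A B A' B' : R} (h : IsCoprime A B) (h' : IsCoprime A' B')
    (m : Ideal R) [hm : m.IsPrime] : ∃ i, symProd A B A' B' i ∉ m := by
  by_contra! H
  have key : ∀ {C D : R}, IsCoprime C D → C ∈ m → D ∈ m → False := by
    rintro C D ⟨a, b, hab⟩ hC hD
    exact hm.ne_top ((Ideal.eq_top_iff_one _).2
      (hab ▸ m.add_mem (m.mul_mem_left _ hC) (m.mul_mem_left _ hD)))
  have h0 : A * A' ∈ m := H 0
  have h1 : A * B' + B * A' ∈ m := H 1
  have h2 : B * B' ∈ m := H 2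
  rcases hm.mem_or_mem h2 with hB | hB'
  · have h3 : A * B' ∈ m := (Submodule.add_mem_iff_left _ (m.mul_mem_right _ hB)).1 h1
    rcases hm.mem_or_mem h3 with hA | hB'
    · exact key h hA hB
    · rcases hm.mem_or_mem h0 with hA | hA'
      exacts [key h hA hB, key h' hA' hB']
  · have h3 : B * A' ∈ m := (Submodule.add_mem_iff_right _ (m.mul_mem_left _ hB')).1 h1
    rcases hm.mem_or_mem h3 with hB | hA'
    · rcases hm.mem_or_mem h0 with hA | hA'
      exacts [key h hA hB, key h' hA' hB']
    · exact key h' hA' hB'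

/-- The polynomials `addSubMap` preserve primitivity, since a combination of them is the fourth
power of a given variable. -/
theorem exists_addSubMap_notMem (E : WeierstrassCurve R) [E.IsElliptic] {s : Fin 3 → R}
    (m : Ideal R) [hm : m.IsPrime] (hs : ∃ i, s i ∉ m) :
    ∃ i, (E.addSubMap i).eval s ∉ m := by
  by_contra! H
  obtain ⟨i, hi⟩ := hs
  refine hi (hm.mem_of_pow_mem 4 ?_)
  rw [← E.addSubMapCoeff_condition s i]
  exact m.sum_mem fun j _ => m.mul_mem_left _ (H j)

/-- Two proportional unimodular vectors differ by a unit. -/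
theorem exists_unit_of_proportional [IsDomain R] {u v : Fin 3 → R}
    (hu : ∀ m : Ideal R, m.IsPrime → ∃ i, u i ∉ m) (hv : ∀ m : Ideal R, m.IsPrime → ∃ i, v i ∉ m)
    (h : ∀ i j, u i * v j = u j * v i) : ∃ e : Rˣ, ∀ i, v i = e * u i := by
  have bez : ∀ w : Fin 3 → R, (∀ m : Ideal R, m.IsPrime → ∃ i, w i ∉ m) →
      ∃ c : Fin 3 → R, ∑ i, c i * w i = 1 := by
    intro w hw
    have : Ideal.span (Set.range w) = ⊤ := by
      by_contra hne
      obtain ⟨m, hm, hle⟩ := Ideal.exists_le_maximal _ hne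
      obtain ⟨i, hi⟩ := hw m hm.isPrime
      exact hi (hle (Ideal.subset_span ⟨i, rfl⟩))
    have h1 : (1 : R) ∈ Ideal.span (Set.range w) := this ▸ Submodule.mem_top
    exact Ideal.mem_span_range_iff_exists_fun.1 h1
  obtain ⟨a, ha⟩ := bez u hu
  obtain ⟨b, hb⟩ := bez v hv
  have e1 : ∀ j, v j = (∑ i, a i * v i) * u j := fun j => by
    calc v j = (∑ i, a i * u i) * v j := by rw [ha, one_mul]
      _ = _ := by
        rw [Finset.sum_mul, Finset.sum_mul]
        exact Finset.sum_congr rfl fun i _ => by rw [mul_assoc, h, mul_assoc, mul_comm (u j)]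
  have e2 : ∀ j, u j = (∑ i, b i * u i) * v j := fun j => by
    calc u j = (∑ i, b i * v i) * u j := by rw [hb, one_mul]
      _ = _ := by
        rw [Finset.sum_mul, Finset.sum_mul]
        exact Finset.sum_congr rfl fun i _ => by rw [mul_assoc, mul_comm (v i), ← h i, mul_assoc, h]
  have h1 : (∑ i, a i * v i) * (∑ i, b i * u i) = 1 := by
    calc _ = ∑ i, b i * ((∑ i, a i * v i) * u i) := by
          rw [Finset.mul_sum]; exact Finset.sum_congr rfl fun i _ => by ring
      _ = ∑ i, b i * v i := Finset.sum_congr rfl fun i _ => by rw [← e1]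
      _ = 1 := hb
  exact ⟨⟨_, _, h1, by rw [mul_comm, h1]⟩, e1⟩

end Unimodular

section Twist

variable {R K : Type*} [CommRing R] [IsDomain R] [Field K] [DecidableEq K] [Algebra R K]

/-- The Weierstrass equation `y² = x³ + a₂ g x² + a₄ g² x + a₆ g³` of the quadratic twist by `g` of
`y² = x³ + a₂ x² + a₄ x + a₆`, over an algebra `K` over the base ring. -/
def twist (K : Type*) [Field K] [Algebra R K] (E : WeierstrassCurve R) (g : R) :
    WeierstrassCurve K where
  a₁ := 0
  a₂ := algebraMap R K (g * E.a₂)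
  a₃ := 0
  a₄ := algebraMap R K (g ^ 2 * E.a₄)
  a₆ := algebraMap R K (g ^ 3 * E.a₆)

/-- The `x`-coordinate of the point `P` of the twist by `g` is `g A / B` in lowest terms. The point
at infinity has `B = 0` and `A` a unit. -/
def IsXRep {E : WeierstrassCurve R} {g : R} (P : (twist K E g).toAffine.Point) (A B : R) : Prop :=
  IsCoprime A B ∧ ∃ k : K, k ≠ 0 ∧ algebraMap R K (g * A) = k * P.xRep 0 ∧
    algebraMap R K B = k * P.xRep 1

/-- If the `x`-coordinates of `P`, `Q`, `P + Q`, `P - Q` are in lowest terms, then the formula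
for the symmetric functions of the last two holds up to a unit: there is no cancellation. -/
theorem IsXRep.exists_unit [FaithfulSMul R K] {E : WeierstrassCurve R} [E.IsElliptic]
    (h₁ : E.a₁ = 0) (h₃ : E.a₃ = 0) {g : R} (hg : g ≠ 0)
    {P Q : (twist K E g).toAffine.Point} {A B A' B' S T S' T' : R} (hP : IsXRep P A B)
    (hQ : IsXRep Q A' B') (hadd : IsXRep (P + Q) S T) (hsub : IsXRep (P - Q) S' T') :
    ∃ e : Rˣ, ∀ i, (E.addSubMap i).eval (symProd A B A' B') = e * symProd S T S' T' i := by
  obtain ⟨cP, p, hp, hp0, hp1⟩ := hP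
  obtain ⟨cQ, q, hq, hq0, hq1⟩ := hQ
  obtain ⟨ca, a, ha, ha0, ha1⟩ := hadd
  obtain ⟨cs, s, hs, hs0, hs1⟩ := hsub
  obtain ⟨k, hk, hk'⟩ := WeierstrassCurve.Affine.Point.sym2x_add_sub
    (W := twist K E g) rfl rfl P Q
  have inj : Function.Injective (algebraMap R K) := FaithfulSMul.algebraMap_injective R K
  have hg' : algebraMap R K g ≠ 0 := fun h => hg (inj (by rw [h, map_zero]))
  refine exists_unit_of_proportional (fun m _ => exists_symProd_notMem ca cs m)
    (fun m _ => exists_addSubMap_notMem E m (exists_symProd_notMem cP cQ m)) ?_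
  -- both vectors are proportional over `K`
  have key : ∀ i, a * s * algebraMap R K g ^ 2 *
      algebraMap R K ((E.addSubMap i).eval (symProd A B A' B')) =
      (p * q) ^ 2 * k * algebraMap R K (symProd S T S' T' i) := by
    have hk0 := hk' 0
    have hk1 := hk' 1
    have hk2 := hk' 2
    have t₁ : (twist K E g).a₁ = 0 := rfl
    have t₂ : (twist K E g).a₂ = algebraMap R K (g * E.a₂) := rfl
    have t₃ : (twist K E g).a₃ = 0 := rfl
    have t₄ : (twist K E g).a₄ = algebraMap R K (g ^ 2 * E.a₄) := rfl
    have t₆ : (twist K E g).a₆ = algebraMap R K (g ^ 3 * E.a₆) := rfl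
    simp [WeierstrassCurve.Affine.Point.sym2x, WeierstrassCurve.addSubMap, t₁, t₂, t₃, t₄, t₆,
      WeierstrassCurve.b₂, WeierstrassCurve.b₄, WeierstrassCurve.b₆, WeierstrassCurve.b₈]
      at hk0 hk1 hk2
    have e : ∀ {C : R} {c : K}, algebraMap R K (g * C) = c →
        algebraMap R K C = c / algebraMap R K g :=
      fun h => by rw [eq_div_iff hg', ← map_mul, mul_comm, h]
    have e2 : algebraMap R K 2 = 2 := map_ofNat _ 2
    have e4 : algebraMap R K 4 = 4 := map_ofNat _ 4
    replace hp0 := e hp0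
    replace hq0 := e hq0
    replace ha0 := e ha0
    replace hs0 := e hs0
    intro i
    fin_cases i
    · simp [symProd, WeierstrassCurve.addSubMap, WeierstrassCurve.b₂, WeierstrassCurve.b₄,
        WeierstrassCurve.b₆, WeierstrassCurve.b₈, hp0, hp1, hq0, hq1, ha0, hs0, h₁, h₃,
        e2, e4]
      field_simp
      linear_combination hk0
    · simp [symProd, WeierstrassCurve.addSubMap, WeierstrassCurve.b₂, WeierstrassCurve.b₄,
        WeierstrassCurve.b₆, WeierstrassCurve.b₈, hp0, hp1, hq0, hq1, ha0, ha1, hs0, hs1, h₁, h₃,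
        e2, e4]
      field_simp
      linear_combination hk1
    · simp [symProd, WeierstrassCurve.addSubMap, WeierstrassCurve.b₂, WeierstrassCurve.b₄,
        WeierstrassCurve.b₆, WeierstrassCurve.b₈, hp0, hp1, hq0, hq1, ha1, hs1, h₁, h₃, e4]
      field_simp
      linear_combination hk2
  intro i j
  apply inj
  apply mul_left_cancel₀ (mul_ne_zero (mul_ne_zero ha hs) (pow_ne_zero 2 hg'))
  rw [map_mul, map_mul]
  linear_combination algebraMap R K (symProd S T S' T' i) * key j -
    algebraMap R K (symProd S T S' T' j) * key i

end Twist

/-! ### Degrees of the numerators of `x`-coordinates -/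

section Degrees

variable {F : Type*} [Field F]

/-- If the coefficient at `U²` of the product of `A U + B V` and `A' U + B' V` has a larger
degree than the other two coefficients, then `deg B' < deg A'`. -/
theorem degree_snd_lt_of_symProd {n : ℕ} {A B A' B' : F[X]}
    (h0 : (symProd A B A' B' 0).natDegree = 2 * n + 2)
    (h1 : (symProd A B A' B' 1).natDegree ≤ 2 * n + 1)
    (h2 : (symProd A B A' B' 2).natDegree ≤ 2 * n + 1) : B'.degree < A'.degree := by
  change (A * A').natDegree = _ at h0
  change (A * B' + B * A').natDegree ≤ _ at h1
  change (B * B').natDegree ≤ _ at h2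
  have hne : A * A' ≠ 0 := by rintro h; rw [h, natDegree_zero] at h0; omega
  have hA := left_ne_zero_of_mul hne
  have hA' := right_ne_zero_of_mul hne
  rw [natDegree_mul hA hA'] at h0
  by_contra! hlt
  have hB' : B' ≠ 0 := by
    rintro rfl
    rw [degree_zero, le_bot_iff, degree_eq_bot] at hlt
    exact hA' hlt
  have hle : A'.natDegree ≤ B'.natDegree := natDegree_le_natDegree hlt
  have hlt' : (B * A').natDegree < (A * B').natDegree := by
    rw [natDegree_mul hA hB']
    rcases eq_or_ne B 0 with rfl | hB
    · rw [zero_mul, natDegree_zero]; omega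
    · rw [natDegree_mul hB hA']
      rw [natDegree_mul hB hB'] at h2
      omega
  rw [natDegree_add_eq_left_of_natDegree_lt hlt', natDegree_mul hA hB'] at h1
  omega

/-- For `x(P) = A / B` with `deg B < deg A` and `x(Q) = X`, the numerator among the polynomials
`addSubMap` has degree `2 deg A + 2` and dominates the other two. -/
theorem natDegree_addSubMap (E : WeierstrassCurve F) {A B : F[X]} (h : B.degree < A.degree) :
    (((E.map C).addSubMap 0).eval (symProd A B X 1)).natDegree = 2 * A.natDegree + 2 ∧
    (((E.map C).addSubMap 1).eval (symProd A B X 1)).natDegree ≤ 2 * A.natDegree + 1 ∧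
    (((E.map C).addSubMap 2).eval (symProd A B X 1)).natDegree ≤ 2 * A.natDegree + 1 := by
  have hA : A ≠ 0 := by rintro rfl; simp at h
  set n := A.natDegree with hn
  have hu : B.natDegree ≤ n := natDegree_le_natDegree h.le
  have hs : (A * X).natDegree = n + 1 := by rw [natDegree_mul hA X_ne_zero, natDegree_X]
  have ht : (A + B * X).natDegree ≤ n := by
    refine natDegree_add_le_of_degree_le le_rfl ?_
    rcases eq_or_ne B 0 with rfl | hB
    · simp
    · rw [natDegree_mul hB X_ne_zero, natDegree_X]
      exact natDegree_lt_natDegree hB h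
  have m : ∀ {p r : F[X]} {a b c : ℕ}, p.natDegree ≤ a → r.natDegree ≤ b → a + b ≤ c →
      (p * r).natDegree ≤ c := fun hp hr hc => (natDegree_mul_le_of_le hp hr).trans hc
  have hc : ∀ (c : F) {p : F[X]} {a : ℕ}, p.natDegree ≤ a → (C c * p).natDegree ≤ a :=
    fun c p a hp => (natDegree_C_mul_le c p).trans hp
  have e2 : (2 : F[X]) = C 2 := rfl
  have e4 : (4 : F[X]) = C 4 := rfl
  have E0 : ((E.map C).addSubMap 0).eval (symProd A B X 1) = (A * X) ^ 2 -
      (C E.b₄ * ((A * X) * B) + C E.b₆ * ((A + B * X) * B) + C E.b₈ * (B * B)) := by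
    simp [WeierstrassCurve.addSubMap, symProd]
    ring
  have E1 : ((E.map C).addSubMap 1).eval (symProd A B X 1) = C 2 * ((A + B * X) * (A * X)) +
      (C E.b₂ * ((A * X) * B) + C E.b₄ * ((A + B * X) * B) + C E.b₆ * (B * B)) := by
    simp [WeierstrassCurve.addSubMap, symProd, ← e2]
    ring
  have E2 : ((E.map C).addSubMap 2).eval (symProd A B X 1) = (A + B * X) * (A + B * X) -
      C 4 * ((A * X) * B) := by
    simp [WeierstrassCurve.addSubMap, symProd, ← e4]
    ring
  have hsB : ((A * X) * B).natDegree ≤ 2 * n + 1 := m hs.le hu (by omega)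
  have htB : ((A + B * X) * B).natDegree ≤ 2 * n + 1 := m ht hu (by omega)
  have hBB : (B * B).natDegree ≤ 2 * n + 1 := m hu hu (by omega)
  refine ⟨?_, ?_, ?_⟩
  · have h2 : ((A * X) ^ 2).natDegree = 2 * n + 2 := by rw [natDegree_pow, hs]; ring
    rw [E0, natDegree_sub_eq_left_of_natDegree_lt, h2]
    rw [h2]
    exact Nat.lt_succ_of_le (natDegree_add_le_of_degree_le (natDegree_add_le_of_degree_le
      (hc _ hsB) (hc _ htB)) (hc _ hBB))
  · rw [E1]
    exact natDegree_add_le_of_degree_le (hc _ (m ht hs.le (by omega)))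
      (natDegree_add_le_of_degree_le (natDegree_add_le_of_degree_le (hc _ hsB) (hc _ htB))
        (hc _ hBB))
  · rw [E2]
    exact (natDegree_sub_le_of_le (m (c := 2 * n + 1) ht ht (by omega)) (hc _ hsB)).trans
      (max_self _).le

end Degrees

section Walk

variable {F : Type*} [Field F] {K : Type*} [Field K] [Algebra F[X] K]
  [IsFractionRing F[X] K]

/-- Every point has an `x`-coordinate in lowest terms, as `F[X]` is a principal ideal domain. -/
theorem exists_isXRep {E : WeierstrassCurve F[X]} {g : F[X]} (hg : g ≠ 0)
    (P : (twist K E g).toAffine.Point) : ∃ A B, IsXRep P A B := by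
  have inj : Function.Injective (algebraMap F[X] K) := IsFractionRing.injective _ _
  have hg' : algebraMap F[X] K g ≠ 0 := fun h => hg (inj (by rw [h, map_zero]))
  rcases P with _ | ⟨x, y, h⟩
  · exact ⟨1, 0, isCoprime_one_left, algebraMap F[X] K g, hg', by
      simp [← WeierstrassCurve.Affine.Point.zero_def]⟩
  · obtain ⟨a, b, hab, hx⟩ := IsFractionRing.exists_reduced_fraction (A := F[X])
      (x / algebraMap F[X] K g)
    have hb : algebraMap F[X] K b ≠ 0 := fun h0 =>
      nonZeroDivisors.ne_zero b.2 (inj (by rw [h0, map_zero]))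
    refine ⟨a, b, hab.isCoprime, algebraMap F[X] K b, hb, ?_, ?_⟩
    · rw [IsFractionRing.mk'_eq_div, div_eq_div_iff hb hg'] at hx
      simp only [WeierstrassCurve.Affine.Point.xRep_some, Matrix.cons_val_zero, map_mul]
      linear_combination hx
    · simp

/-- Adding to or subtracting from a point of the twist the point `(g X, _)` gives two points for
which the degrees of the numerators of the `x`-coordinates are those of a quadratic recursion. -/
theorem natDegree_add_natDegree_eq [DecidableEq K] (E : WeierstrassCurve F) [E.IsElliptic]
    (h₁ : E.a₁ = 0) (h₃ : E.a₃ = 0) {g : F[X]} (hg : g ≠ 0)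
    {P Q : (twist K (E.map C) g).toAffine.Point}
    {A B S T S' T' : F[X]} (hQ : IsXRep Q X 1) (hP : IsXRep P A B) (hadd : IsXRep (P + Q) S T)
    (hsub : IsXRep (P - Q) S' T') (hlt : B.degree < A.degree) :
    S.natDegree + S'.natDegree = 2 * A.natDegree + 2 ∧ T.degree < S.degree ∧
      T'.degree < S'.degree := by
  obtain ⟨e, he⟩ := hP.exists_unit (by simp [h₁]) (by simp [h₃]) hg hQ hadd hsub
  obtain ⟨d0, d1, d2⟩ := natDegree_addSubMap E hlt
  have hmul : ∀ p : F[X], ((e : F[X]) * p).natDegree = p.natDegree := fun p => by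
    rcases eq_or_ne p 0 with rfl | hp
    · simp
    · rw [natDegree_mul e.ne_zero hp, natDegree_coe_units, zero_add]
  rw [he, hmul] at d0 d1 d2
  refine ⟨?_, ?_, degree_snd_lt_of_symProd d0 d1 d2⟩
  · have hne : S * S' ≠ 0 := by
      intro h
      change (S * S').natDegree = _ at d0
      rw [h, natDegree_zero] at d0
      omega
    rw [← natDegree_mul (left_ne_zero_of_mul hne) (right_ne_zero_of_mul hne)]
    exact d0
  · refine degree_snd_lt_of_symProd (A := S') (B := T') (n := A.natDegree) ?_ ?_ ?_
    · rw [← d0]; simp [symProd, mul_comm]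
    · refine le_trans (le_of_eq ?_) d1; simp [symProd, mul_comm, add_comm]
    · refine le_trans (le_of_eq ?_) d2; simp [symProd, mul_comm]

theorem IsXRep.degree_unique {E : WeierstrassCurve F[X]} {g : F[X]} (hg : g ≠ 0)
    {P : (twist K E g).toAffine.Point} {A B A' B' : F[X]} (h : IsXRep P A B)
    (h' : IsXRep P A' B') : A.degree = A'.degree ∧ B.degree = B'.degree := by
  obtain ⟨c, k, hk, h0, h1⟩ := h
  obtain ⟨c', k', hk', h0', h1'⟩ := h'
  have inj : Function.Injective (algebraMap F[X] K) := IsFractionRing.injective _ _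
  have e : A * B' = A' * B := by
    refine mul_left_cancel₀ hg (inj ?_)
    rw [← mul_assoc, ← mul_assoc, map_mul, h0, h1', map_mul, h0', h1]
    ring
  have d1 : A ∣ A' := c.dvd_of_dvd_mul_right ⟨B', e.symm⟩
  have d2 : A' ∣ A := c'.dvd_of_dvd_mul_right ⟨B, e⟩
  have d3 : B ∣ B' := c.symm.dvd_of_dvd_mul_left ⟨A', by rw [e, mul_comm]⟩
  have d4 : B' ∣ B := c'.symm.dvd_of_dvd_mul_left ⟨A, by rw [← e, mul_comm]⟩
  exact ⟨degree_eq_degree_of_associated (associated_of_dvd_dvd d1 d2),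
    degree_eq_degree_of_associated (associated_of_dvd_dvd d3 d4)⟩

theorem IsXRep.natDegree_unique {E : WeierstrassCurve F[X]} {g : F[X]} (hg : g ≠ 0)
    {P : (twist K E g).toAffine.Point} {A B A' B' : F[X]} (h : IsXRep P A B)
    (h' : IsXRep P A' B') : A.natDegree = A'.natDegree :=
  natDegree_eq_of_degree_eq (h.degree_unique hg h').1

end Walk

/-- A quadratic polynomial with odd constant term that is nonnegative at the integers has a
nonpositive discriminant. For `t = 2 s + 1` its value at `-s` is `q - (s² + s)`, which is odd and
thus positive. -/
theorem sq_le_four_mul_of_forall_nonneg {q t : ℤ} (hq : Odd q)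
    (h : ∀ n : ℤ, 0 ≤ n ^ 2 + t * n + q) : t ^ 2 ≤ 4 * q := by
  rcases Int.even_or_odd' t with ⟨s, rfl | rfl⟩
  · nlinarith [h (-s)]
  · have h1 := h (-s)
    have h2 : q ≠ s ^ 2 + s := by
      rintro rfl
      have : Even (s ^ 2 + s) := by rw [sq, ← mul_add_one]; exact Int.even_mul_succ_self s
      exact (Int.not_even_iff_odd.2 hq) this
    have h3 : s ^ 2 + s < q := lt_of_le_of_ne (by nlinarith) (Ne.symm h2)
    nlinarith

/-- A function on the integers with constant second difference two is a quadratic polynomial. -/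
theorem eq_of_second_difference {d : ℤ → ℤ} (h : ∀ n, d (n + 1) + d (n - 1) = 2 * d n + 2) (n : ℤ) :
    d n = n ^ 2 + (d 0 + 1 - d (-1)) * n + d 0 := by
  have key : ∀ n, d n = n ^ 2 + (d 0 + 1 - d (-1)) * n + d 0 ∧
      d (n - 1) = (n - 1) ^ 2 + (d 0 + 1 - d (-1)) * (n - 1) + d 0 := by
    intro n
    induction n with
    | zero => constructor <;> ring_nf
    | succ k ih =>
      have := h k
      rw [add_sub_cancel_right]
      refine ⟨by linear_combination this - ih.2 + 2 * ih.1, by linear_combination ih.1⟩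
    | pred k ih =>
      have := h (-(k : ℤ) - 1)
      rw [sub_add_cancel] at this
      refine ⟨ih.2, by linear_combination this - ih.1 + 2 * ih.2⟩
  exact (key n).1

/-! ### Counting solutions of `w² = f(x)` -/

section SquareCounts

variable {F : Type*} [Field F]

/-- The number of affine points of the curve `w² = f(x)`. -/
noncomputable def sqCount (f : F → F) : ℕ := Nat.card {p : F × F // p.2 ^ 2 = f p.1}

theorem card_sqrts [Fintype F] [DecidableEq F] (hF : ringChar F ≠ 2) (a : F) :
    Nat.card {w : F // w ^ 2 = a} =
      (if a = 0 then 1 else 0) + 2 * (if quadraticChar F a = 1 then 1 else 0) := by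
  have h := quadraticChar_card_sqrts hF a
  have e : Nat.card {w : F // w ^ 2 = a} = {x : F | x ^ 2 = a}.toFinset.card := by
    rw [Nat.card_eq_fintype_card, Set.toFinset_card]
    rfl
  rw [e]
  zify
  rw [h]
  rcases eq_or_ne a 0 with rfl | ha
  · simp
  · rcases quadraticChar_dichotomy ha with h1 | h1 <;> simp [ha, h1]

theorem sqCount_eq_sum [Fintype F] (f : F → F) :
    sqCount f = ∑ x, Nat.card {w : F // w ^ 2 = f x} := by
  rw [sqCount, ← Nat.card_sigma]
  exact Nat.card_congr (Equiv.subtypeProdEquivSigmaSubtype fun x w => w ^ 2 = f x)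

theorem sqCount_eq [Fintype F] [DecidableEq F] (hF : ringChar F ≠ 2) (f : F → F) :
    sqCount f = (Finset.univ.filter fun x => f x = 0).card +
      2 * (Finset.univ.filter fun x => quadraticChar F (f x) = 1).card := by
  simp_rw [sqCount_eq_sum, card_sqrts hF, Finset.sum_add_distrib, ← Finset.mul_sum,
    Finset.card_filter]

theorem card_eq_add_add [Fintype F] [DecidableEq F] (f : F → F) :
    Fintype.card F = (Finset.univ.filter fun x => f x = 0).card +
      (Finset.univ.filter fun x => quadraticChar F (f x) = 1).card +
      (Finset.univ.filter fun x => quadraticChar F (f x) = -1).card := by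
  rw [← Finset.card_univ, Finset.card_eq_sum_ones]
  simp_rw [Finset.card_filter, ← Finset.sum_add_distrib]
  refine Finset.sum_congr rfl fun x _ => ?_
  rcases eq_or_ne (f x) 0 with h | h
  · simp [h]
  · rcases quadraticChar_dichotomy h with h1 | h1 <;> simp [h, h1]

end SquareCounts

/-! ### Separable products of linear factors -/

section Products

variable {F : Type*} [Field F]

/-- The monic polynomial with simple roots at the elements of `s`. -/
noncomputable def rootsPoly (s : Finset F) : F[X] := ∏ a ∈ s, (X - C a)

theorem natDegree_rootsPoly (s : Finset F) : (rootsPoly s).natDegree = s.card :=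
  natDegree_finsetProd_X_sub_C_eq_card s fun a => a

theorem rootsPoly_ne_zero (s : Finset F) : rootsPoly s ≠ 0 :=
  Finset.prod_ne_zero_iff.2 fun a _ => X_sub_C_ne_zero a

theorem rootsPoly_dvd {s : Finset F} {f : F[X]} (h : ∀ a ∈ s, f.eval a = 0) : rootsPoly s ∣ f :=
  Finset.prod_dvd_of_coprime
    (fun _ _ _ _ hab => pairwise_coprime_X_sub_C Function.injective_id hab)
    fun a ha => dvd_iff_isRoot.2 (h a ha)

theorem isCoprime_rootsPoly {s : Finset F} {f : F[X]} (h : ∀ a ∈ s, f.eval a ≠ 0) :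
    IsCoprime (rootsPoly s) f :=
  IsCoprime.prod_left fun a ha => (irreducible_X_sub_C a).coprime_iff_not_dvd.2
    fun hd => h a ha (dvd_iff_isRoot.1 hd)

theorem eval_rootsPoly_eq_zero {s : Finset F} {a : F} (ha : a ∈ s) : (rootsPoly s).eval a = 0 := by
  rw [rootsPoly, eval_prod]
  exact Finset.prod_eq_zero ha (by simp)

/-- `X^q - X` factored according to the quadratic character of `f(x)`. -/
theorem X_pow_card_sub_X_eq [Fintype F] [DecidableEq F] (f : F → F) :
    (X ^ Fintype.card F - X : F[X]) = rootsPoly (Finset.univ.filter fun x => f x = 0) *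
      rootsPoly (Finset.univ.filter fun x => quadraticChar F (f x) = 1) *
      rootsPoly (Finset.univ.filter fun x => quadraticChar F (f x) = -1) := by
  have h1 : (X ^ Fintype.card F - X : F[X]) = ∏ a : F, (X - C a) := by
    have := FiniteField.X_pow_card_sub_X_natDegree_eq F (Fintype.one_lt_card (α := F))
    have hm : (X ^ Fintype.card F - X : F[X]).Monic :=
      monic_X_pow_sub (by rw [degree_X]; exact_mod_cast Fintype.one_lt_card (α := F))
    have h := prod_multiset_X_sub_C_of_monic_of_roots_card_eq hm (by
      rw [FiniteField.roots_X_pow_card_sub_X, this]; rfl)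
    rw [FiniteField.roots_X_pow_card_sub_X] at h
    exact h.symm
  rw [h1]
  simp_rw [rootsPoly, Finset.prod_filter, ← Finset.prod_mul_distrib]
  refine Finset.prod_congr rfl fun x _ => ?_
  rcases eq_or_ne (f x) 0 with h | h
  · simp [h]
  · rcases quadraticChar_dichotomy h with h1 | h1 <;> simp [h, h1]

end Products

/-! ### The difference of the Frobenius point and the generic point -/

section Cubic

variable {F : Type*} [Field F]

/-- The cubic `X³ + a₂ X² + a₄ X + a₆`. -/
noncomputable def cubicPoly (E : WeierstrassCurve F) : F[X] :=
  X ^ 3 + C E.a₂ * X ^ 2 + C E.a₄ * X + C E.a₆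

theorem eval_cubicPoly (E : WeierstrassCurve F) (x : F) :
    (cubicPoly E).eval x = x ^ 3 + E.a₂ * x ^ 2 + E.a₄ * x + E.a₆ := by
  simp [cubicPoly]

theorem natDegree_cubicPoly (E : WeierstrassCurve F) : (cubicPoly E).natDegree = 3 := by
  rw [cubicPoly]; compute_degree!

theorem cubicPoly_ne_zero (E : WeierstrassCurve F) : cubicPoly E ≠ 0 := by
  intro h
  have := natDegree_cubicPoly E
  rw [h, natDegree_zero] at this
  omega

theorem derivative_cubicPoly_ne_zero (E : WeierstrassCurve F) [E.IsElliptic] (h₁ : E.a₁ = 0)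
    (h₃ : E.a₃ = 0) {x : F} (hx : (cubicPoly E).eval x = 0) :
    (derivative (cubicPoly E)).eval x ≠ 0 := by
  rw [eval_cubicPoly] at hx
  have h : E.toAffine.Nonsingular x 0 := by
    rw [← WeierstrassCurve.Affine.equation_iff_nonsingular, WeierstrassCurve.Affine.equation_iff,
      h₁, h₃]
    linear_combination -hx
  intro h0
  rw [WeierstrassCurve.Affine.nonsingular_iff, h₁, h₃] at h
  simp [cubicPoly] at h0
  rcases h.2 with h | h
  · exact h (by linear_combination -h0)
  · exact h (by ring)

variable [Fintype F]

theorem cubicPoly_pow_card (E : WeierstrassCurve F) : cubicPoly E ^ Fintype.card F =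
    X ^ (3 * Fintype.card F) + C E.a₂ * X ^ (2 * Fintype.card F) +
      C E.a₄ * X ^ Fintype.card F + C E.a₆ := by
  rw [← FiniteField.expand_card, cubicPoly]
  simp only [map_add, map_mul, map_pow, expand_C, expand_X]
  ring

/-- The `x`-coordinate of the difference between the Frobenius point and the generic point, on the
twist by the cubic and divided by the cubic: its numerator before cancellation. -/
noncomputable def frobNum (E : WeierstrassCurve F) : F[X] :=
  cubicPoly E * (cubicPoly E ^ (Fintype.card F / 2) + 1) ^ 2 -
    (C E.a₂ + X + X ^ Fintype.card F) * (X ^ Fintype.card F - X) ^ 2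

/-- The terms of degree `3 q` cancel, because `g^q = g(X^q)` for the cubic `g`. -/
theorem natDegree_frobNum (hF : ringChar F ≠ 2) (E : WeierstrassCurve F) :
    (frobNum E).natDegree = 2 * Fintype.card F + 1 := by
  set q := Fintype.card F with hq
  have hodd : q % 2 = 1 := FiniteField.odd_card_of_char_ne_two hF
  have hq1 : 1 < q := Fintype.one_lt_card
  obtain ⟨m, hm⟩ : ∃ m, q = 2 * m + 1 := ⟨q / 2, by omega⟩
  have hm' : q / 2 = m := by omega
  have hpow := cubicPoly_pow_card E
  rw [← hq, hm] at hpow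
  have e : frobNum E = X ^ (2 * q + 1) + (C E.a₄ * X ^ q + C E.a₆ + C 2 * cubicPoly E ^ (m + 1) +
      cubicPoly E + C (2 * E.a₂) * X ^ (q + 1) - C E.a₂ * X ^ 2 + X ^ (q + 2) - X ^ 3) := by
    have e2 : (C 2 : F[X]) = 2 := rfl
    rw [frobNum, ← hq, hm', hm, C_mul, e2]
    linear_combination hpow
  have hg : (C 2 * cubicPoly E ^ (m + 1)).natDegree ≤ 2 * q := by
    refine (natDegree_C_mul_le _ _).trans ?_
    rw [natDegree_pow, natDegree_cubicPoly]
    omega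
  have hg' : (cubicPoly E).natDegree ≤ 2 * q := by rw [natDegree_cubicPoly]; omega
  have hx : ∀ {k : ℕ} (c : F), k ≤ 2 * q → (C c * X ^ k).natDegree ≤ 2 * q := fun c hk =>
    (natDegree_C_mul_X_pow_le c _).trans hk
  have hx' : ∀ {k : ℕ}, k ≤ 2 * q → (X ^ k : F[X]).natDegree ≤ 2 * q := fun hk =>
    (natDegree_X_pow_le _).trans hk
  have ha : ∀ {f g : F[X]}, f.natDegree ≤ 2 * q → g.natDegree ≤ 2 * q →
    (f + g).natDegree ≤ 2 * q := fun hf hg => natDegree_add_le_of_degree_le hf hg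
  have hs : ∀ {f g : F[X]}, f.natDegree ≤ 2 * q → g.natDegree ≤ 2 * q →
    (f - g).natDegree ≤ 2 * q := fun hf hg => (natDegree_sub_le_of_le hf hg).trans (max_self _).le
  rw [e, natDegree_add_eq_left_of_natDegree_lt, natDegree_X_pow]
  rw [natDegree_X_pow]
  refine Nat.lt_succ_of_le (hs (ha (hs (ha (ha (ha (ha (hx _ (by omega)) ?_) hg) hg')
    (hx _ (by omega))) (hx _ (by omega))) (hx' (by omega))) (hx' (by omega)))
  rw [natDegree_C]
  omega

/-- In lowest terms, the numerator of `frobNum / (X^q - X)²` has as its degree the number of points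
of the elliptic curve. -/
theorem exists_lowest_terms_frobNum [DecidableEq F] (hF : ringChar F ≠ 2) (E : WeierstrassCurve F)
    [E.IsElliptic] (h₁ : E.a₁ = 0) (h₃ : E.a₃ = 0) :
    ∃ h A B : F[X], h ≠ 0 ∧ frobNum E = h * A ∧ (X ^ Fintype.card F - X) ^ 2 = h * B ∧
      IsCoprime A B ∧ A.natDegree = sqCount (fun x => (cubicPoly E).eval x) + 1 := by
  set f : F → F := fun x => (cubicPoly E).eval x with hf
  set s0 := Finset.univ.filter fun x => f x = 0
  set s1 := Finset.univ.filter fun x => quadraticChar F (f x) = 1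
  set s2 := Finset.univ.filter fun x => quadraticChar F (f x) = -1
  have chi : ∀ x, f x ^ (Fintype.card F / 2) = (quadraticChar F (f x) : F) := fun x =>
    (quadraticChar_eq_pow_of_char_ne_two' hF _).symm
  obtain ⟨g, hg⟩ : rootsPoly s0 ∣ cubicPoly E :=
    rootsPoly_dvd fun a ha => (Finset.mem_filter.1 ha).2
  obtain ⟨u, hu⟩ : rootsPoly s2 ∣ cubicPoly E ^ (Fintype.card F / 2) + 1 :=
    rootsPoly_dvd fun a ha => by
      rw [eval_add, eval_pow, eval_one]
      change f a ^ _ + 1 = 0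
      rw [chi, (Finset.mem_filter.1 ha).2]
      simp
  have hX := X_pow_card_sub_X_eq f
  set B := rootsPoly s0 * rootsPoly s1 ^ 2 with hB
  -- `h = rootsPoly s0 * rootsPoly s2 ^ 2` is the greatest common divisor: it contains the roots of
  -- `g` once and those of `g ^ ((q - 1) / 2) + 1` twice
  set A := g * u ^ 2 - (C E.a₂ + X + X ^ Fintype.card F) * B with hA
  have hnum : frobNum E = rootsPoly s0 * rootsPoly s2 ^ 2 * A := by
    rw [frobNum, hu, hX, hg, hA, hB]
    ring
  have hne : rootsPoly s0 * rootsPoly s2 ^ 2 ≠ 0 :=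
    mul_ne_zero (rootsPoly_ne_zero _) (pow_ne_zero 2 (rootsPoly_ne_zero _))
  have hchar : (2 : F) ≠ 0 := Ring.two_ne_zero hF
  have hg0 : ∀ a ∈ s0, g.eval a ≠ 0 := by
    intro a ha h0
    refine derivative_cubicPoly_ne_zero E h₁ h₃ (Finset.mem_filter.1 ha).2 ?_
    rw [hg, derivative_mul, eval_add, eval_mul, eval_mul, h0, eval_rootsPoly_eq_zero ha]
    ring
  have hg1 : ∀ a ∈ s1, g.eval a ≠ 0 := by
    intro a ha h0
    have : f a = 0 := by
      change (cubicPoly E).eval a = 0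
      rw [hg, eval_mul, h0, mul_zero]
    have h1 := (Finset.mem_filter.1 ha).2
    rw [this] at h1
    simp at h1
  have hu' : ∀ a, (f a = 0 ∨ quadraticChar F (f a) = 1) → u.eval a ≠ 0 := by
    intro a ha h0
    have h1 : f a ^ (Fintype.card F / 2) + 1 = 0 := by
      change (cubicPoly E).eval a ^ _ + 1 = 0
      rw [← eval_pow, ← eval_one (x := a), ← eval_add, hu, eval_mul, h0, mul_zero]
    rw [chi] at h1
    rcases ha with ha | ha
    · rw [ha] at h1; simp at h1
    · rw [ha] at h1
      exact hchar (by push_cast at h1; linear_combination h1)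
  refine ⟨_, A, B, hne, hnum, by rw [hX, hB]; ring, ?_, ?_⟩
  · have c1 : IsCoprime B (g * u ^ 2) := by
      refine IsCoprime.mul_left (isCoprime_rootsPoly fun a ha => ?_)
        (IsCoprime.pow_left (isCoprime_rootsPoly fun a ha => ?_))
      · rw [eval_mul, eval_pow]
        exact mul_ne_zero (hg0 a ha) (pow_ne_zero 2 (hu' a (Or.inl (Finset.mem_filter.1 ha).2)))
      · rw [eval_mul, eval_pow]
        exact mul_ne_zero (hg1 a ha) (pow_ne_zero 2 (hu' a (Or.inr (Finset.mem_filter.1 ha).2)))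
    have c2 := c1.add_mul_left_right (-(C E.a₂ + X + X ^ Fintype.card F))
    have e : A = g * u ^ 2 + B * -(C E.a₂ + X + X ^ Fintype.card F) := by rw [hA]; ring
    rw [e]
    exact c2.symm
  · have hA0 : A ≠ 0 := by
      intro h0
      have := natDegree_frobNum hF E
      rw [hnum, h0, mul_zero, natDegree_zero] at this
      omega
    have h := natDegree_frobNum hF E
    rw [hnum, natDegree_mul hne hA0, natDegree_mul (rootsPoly_ne_zero _)
      (pow_ne_zero 2 (rootsPoly_ne_zero _)), natDegree_pow, natDegree_rootsPoly,
      natDegree_rootsPoly] at h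
    have h2 := card_eq_add_add f
    rw [sqCount_eq hF]
    change A.natDegree = s0.card + 2 * s1.card + 1
    change _ = s0.card + s1.card + s2.card at h2
    omega

end Cubic

/-! ### Hasse's bound -/

section Hasse

variable {F : Type*} [Field F]

theorem twist_equation {R K : Type*} [CommRing R] [Field K] [Algebra R K] (E : WeierstrassCurve R)
    (g : R) {x y : R}
    (h : g * y ^ 2 = x ^ 3 + E.a₂ * x ^ 2 + E.a₄ * x + E.a₆) :
    (twist K E g).toAffine.Equation (algebraMap R K (g * x)) (algebraMap R K (g ^ 2 * y)) := by
  rw [WeierstrassCurve.Affine.equation_iff]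
  simp only [twist, ← map_pow, ← map_mul, ← map_add, zero_mul, add_zero]
  congr 1
  linear_combination g ^ 3 * h

theorem twist_nonsingular {R K : Type*} [CommRing R] [IsDomain R] [Field K] [Algebra R K]
    [FaithfulSMul R K] (E : WeierstrassCurve R) {g : R} {x y : R} (hg : g ≠ 0) (hy : y ≠ 0)
    (h2 : (2 : R) ≠ 0) (h : g * y ^ 2 = x ^ 3 + E.a₂ * x ^ 2 + E.a₄ * x + E.a₆) :
    (twist K E g).toAffine.Nonsingular (algebraMap R K (g * x)) (algebraMap R K (g ^ 2 * y)) := by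
  refine (WeierstrassCurve.Affine.nonsingular_iff ..).2 ⟨twist_equation E g h, Or.inr fun h0 => ?_⟩
  have inj : Function.Injective (algebraMap R K) := FaithfulSMul.algebraMap_injective R K
  refine mul_ne_zero h2 (mul_ne_zero (pow_ne_zero 2 hg) hy) (inj ?_)
  simp only [twist] at h0
  rw [map_zero, map_mul, map_ofNat]
  linear_combination h0

theorem isXRep_some {R K : Type*} [CommRing R] [IsDomain R] [Field K] [Algebra R K]
    {E : WeierstrassCurve R} {g x : R} {y : K}
    (h : (twist K E g).toAffine.Nonsingular (algebraMap R K (g * x)) y) :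
    IsXRep (.some _ _ h) x 1 :=
  ⟨isCoprime_one_right, 1, one_ne_zero, by simp, by simp⟩

/-- Hasse's bound for an elliptic curve `y² = x³ + a₂ x² + a₄ x + a₆`. -/
theorem sq_sub_sqCount_le [Fintype F] (hF : ringChar F ≠ 2) (E : WeierstrassCurve F)
    [E.IsElliptic] (h₁ : E.a₁ = 0) (h₃ : E.a₃ = 0) :
    ((Fintype.card F : ℤ) - sqCount (fun x => (cubicPoly E).eval x)) ^ 2 ≤ 4 * Fintype.card F := by
  classical
  set q := Fintype.card F with hq
  have hodd : q % 2 = 1 := FiniteField.odd_card_of_char_ne_two hF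
  have hq1 : 1 < q := Fintype.one_lt_card
  set K := FractionRing F[X]
  set g := cubicPoly E with hg
  have hg0 : g ≠ 0 := cubicPoly_ne_zero E
  have h2 : (2 : F[X]) ≠ 0 := by
    intro h
    have h' : (C 2 : F[X]) = 0 := h
    exact Ring.two_ne_zero hF (C_eq_zero.1 h')
  have inj : Function.Injective (algebraMap F[X] K) := IsFractionRing.injective _ _
  have nP := twist_nonsingular (K := K) (E.map C) (x := X) hg0 one_ne_zero h2
    (by rw [hg, cubicPoly]; simp)
  have nFr := twist_nonsingular (K := K) (E.map C) (x := X ^ q) (y := g ^ (q / 2)) hg0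
    (pow_ne_zero _ hg0) h2 (by
      have hp := cubicPoly_pow_card E
      have e : g * (g ^ (q / 2)) ^ 2 = g ^ q := by
        rw [← pow_mul, ← pow_succ']
        congr 1
        omega
      rw [e, hp]
      simp only [WeierstrassCurve.map_a₂, WeierstrassCurve.map_a₄, WeierstrassCurve.map_a₆]
      ring)
  -- the generic point `(g X, g²)` and the Frobenius point `(g X^q, g² g^((q - 1) / 2))`
  set P : (twist K (E.map C) g).toAffine.Point := .some _ _ nP with hP
  set Fr : (twist K (E.map C) g).toAffine.Point := .some _ _ nFr with hFr
  have repP : IsXRep P X 1 := isXRep_some nP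
  have repFr : IsXRep Fr (X ^ q) 1 := isXRep_some nFr
  -- the `x`-coordinates `g A(n) / B(n)` of the points `Fr + n P`
  choose A B hAB using fun n : ℤ => exists_isXRep hg0 (Fr + n • P)
  have hadd : ∀ n : ℤ, IsXRep (Fr + n • P + P) (A (n + 1)) (B (n + 1)) := fun n => by
    have := hAB (n + 1)
    rwa [add_zsmul, one_zsmul, ← add_assoc] at this
  have hsub : ∀ n : ℤ, IsXRep (Fr + n • P - P) (A (n - 1)) (B (n - 1)) := fun n => by
    have := hAB (n - 1)
    rwa [sub_zsmul, one_zsmul, ← add_assoc, ← sub_eq_add_neg] at this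
  have step : ∀ n, (B n).degree < (A n).degree → _ := fun n hn =>
    natDegree_add_natDegree_eq E h₁ h₃ hg0 repP (hAB n) (hadd n) (hsub n) hn
  have hd0 : (A 0).natDegree = q := by
    have h := hAB 0
    rw [zero_zsmul, add_zero] at h
    rw [h.natDegree_unique hg0 repFr, natDegree_X_pow]
  have hlt : ∀ n, (B n).degree < (A n).degree := by
    intro n
    induction n with
    | zero =>
      have h := hAB 0
      rw [zero_zsmul, add_zero] at h
      rw [(h.degree_unique hg0 repFr).1, (h.degree_unique hg0 repFr).2, degree_one, degree_X_pow]
      exact_mod_cast (by omega : 0 < q)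
    | succ k ih => exact (step _ ih).2.1
    | pred k ih => exact (step _ ih).2.2
  -- the number of points on the curve is the degree of `A(-1)`
  have hdm : (A (-1)).natDegree = sqCount (fun x => g.eval x) + 1 := by
    obtain ⟨h, A', B', hh, hA', hB', hcop, hdeg⟩ := exists_lowest_terms_frobNum hF E h₁ h₃
    rw [← hdeg]
    refine (hAB (-1)).natDegree_unique (B' := B') hg0 ?_
    rw [neg_zsmul, one_zsmul]
    have hXq : (X ^ q - X : F[X]) ≠ 0 := by
      intro h0
      have := FiniteField.X_pow_card_sub_X_natDegree_eq F hq1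
      rw [h0, natDegree_zero] at this
      omega
    have hB'0 : B' ≠ 0 := by
      rintro rfl
      rw [mul_zero] at hB'
      exact hXq (pow_eq_zero_iff two_ne_zero |>.1 hB')
    have hgK : algebraMap F[X] K g ≠ 0 := fun h => hg0 (inj (by rw [h, map_zero]))
    have hhK : algebraMap F[X] K h ≠ 0 := fun h' => hh (inj (by rw [h', map_zero]))
    have hBK : algebraMap F[X] K B' ≠ 0 := fun h' => hB'0 (inj (by rw [h', map_zero]))
    have hXK : algebraMap F[X] K (X ^ q - X) ≠ 0 := fun h' => hXq (inj (by rw [h', map_zero]))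
    have hne : algebraMap F[X] K (g * X ^ q) ≠ algebraMap F[X] K (g * X) := by
      intro h'
      exact hXq (sub_eq_zero.2 (mul_left_cancel₀ hg0 (inj h')))
    refine ⟨hcop, algebraMap F[X] K B', hBK, ?_, ?_⟩
    · rw [hFr, hP, WeierstrassCurve.Affine.Point.neg_some,
        WeierstrassCurve.Affine.Point.add_of_X_ne hne, WeierstrassCurve.Affine.Point.xRep_some,
        WeierstrassCurve.Affine.slope_of_X_ne hne, WeierstrassCurve.Affine.addX,
        WeierstrassCurve.Affine.negY]
      have e1 : algebraMap F[X] K (frobNum E) = algebraMap F[X] K h * algebraMap F[X] K A' := by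
        rw [hA', map_mul]
      have e2 : algebraMap F[X] K (X ^ q - X) ^ 2 = algebraMap F[X] K h * algebraMap F[X] K B' := by
        rw [← map_pow, hB', map_mul]
      rw [map_mul, map_mul] at hne
      have hs := sub_ne_zero.2 hne
      rw [frobNum] at e1
      simp only [map_mul, map_sub, map_add, map_pow, map_one] at e1 e2 hXK hs ⊢
      simp only [twist, map_mul, map_pow, Matrix.cons_val_zero, WeierstrassCurve.map_a₂]
      have hslope : ((algebraMap F[X] K) g ^ 2 * (algebraMap F[X] K) g ^ (q / 2) -
          (-((algebraMap F[X] K) g ^ 2 * 1) - 0 * ((algebraMap F[X] K) g * (algebraMap F[X] K) X) -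
            0)) / ((algebraMap F[X] K) g * (algebraMap F[X] K) X ^ q -
              (algebraMap F[X] K) g * (algebraMap F[X] K) X) =
          algebraMap F[X] K g * (algebraMap F[X] K g ^ (q / 2) + 1) /
            (algebraMap F[X] K X ^ q - algebraMap F[X] K X) := by
        rw [div_eq_div_iff hs hXK]
        ring
      rw [hslope]
      apply mul_left_cancel₀ hhK
      rw [← hg, ← hq] at e1
      conv_rhs => rw [← mul_assoc, ← e2]
      have e3 : (algebraMap F[X] K X ^ q - algebraMap F[X] K X) ^ 2 *
          (algebraMap F[X] K g * (algebraMap F[X] K g ^ (q / 2) + 1) /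
            (algebraMap F[X] K X ^ q - algebraMap F[X] K X)) ^ 2 =
          (algebraMap F[X] K g * (algebraMap F[X] K g ^ (q / 2) + 1)) ^ 2 := by
        rw [← mul_pow, mul_div_cancel₀ _ hXK]
      linear_combination -e3 - (algebraMap F[X] K g) * e1
    · rw [hFr, hP, WeierstrassCurve.Affine.Point.neg_some,
        WeierstrassCurve.Affine.Point.add_of_X_ne hne, WeierstrassCurve.Affine.Point.xRep_some]
      simp
  -- so `deg A(n) = n² + t n + q`, with `t = q - #{w² = g(x)}`
  have hquad := eq_of_second_difference (d := fun n => ((A n).natDegree : ℤ))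
    (fun n => by exact_mod_cast (step n (hlt n)).1)
  simp only [hd0, hdm] at hquad
  have := sq_le_four_mul_of_forall_nonneg (q := q) (t := q - sqCount (fun x => g.eval x))
    (by rw [Int.odd_iff]; omega) (fun n => by
      have h := hquad n
      have h' : (0 : ℤ) ≤ (A n).natDegree := Int.natCast_nonneg _
      rw [h] at h'
      push_cast at h'
      linarith)
  exact this

end Hasse

/-! ### Points and two-torsion of a Weierstrass curve -/

section TwoTorsion

variable {F : Type*} [Field F]

/-- The polynomial function `4 x³ + b₂ x² + 2 b₄ x + b₆`, which is `(2 y + a₁ x + a₃)²` at a point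
`(x, y)` of the curve. -/
def psi (W : WeierstrassCurve F) (x : F) : F := 4 * x ^ 3 + W.b₂ * x ^ 2 + 2 * W.b₄ * x + W.b₆

/-- The number of zeros of a function on `F`. -/
noncomputable def rootCount (f : F → F) : ℕ := Nat.card {x : F // f x = 0}

theorem equation_iff_psi (h2 : (2 : F) ≠ 0) (W : WeierstrassCurve F) (x y : F) :
    W.toAffine.Equation x y ↔ (2 * y + W.a₁ * x + W.a₃) ^ 2 = psi W x := by
  rw [WeierstrassCurve.Affine.equation_iff, psi, WeierstrassCurve.b₂, WeierstrassCurve.b₄,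
    WeierstrassCurve.b₆]
  constructor
  · intro h
    linear_combination 4 * h
  · intro h
    refine mul_left_cancel₀ (mul_ne_zero h2 h2) ?_
    linear_combination h

/-- Completing the square gives a bijection from the affine points to the solutions of
`w² = 4 x³ + b₂ x² + 2 b₄ x + b₆`. -/
noncomputable def equationEquiv (h2 : (2 : F) ≠ 0) (W : WeierstrassCurve F) :
    {p : F × F // W.toAffine.Equation p.1 p.2} ≃ {p : F × F // p.2 ^ 2 = psi W p.1} where
  toFun p := ⟨(p.1.1, 2 * p.1.2 + W.a₁ * p.1.1 + W.a₃), (equation_iff_psi h2 W _ _).1 p.2⟩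
  invFun p := ⟨(p.1.1, (p.1.2 - W.a₁ * p.1.1 - W.a₃) / 2), by
    rw [equation_iff_psi h2, mul_div_cancel₀ _ h2, ← p.2]
    ring⟩
  left_inv p := by
    ext
    · rfl
    · change (2 * p.1.2 + W.a₁ * p.1.1 + W.a₃ - W.a₁ * p.1.1 - W.a₃) / 2 = p.1.2
      rw [div_eq_iff h2]
      ring
  right_inv p := by
    ext
    · rfl
    · simp only [mul_div_cancel₀ _ h2]
      ring

theorem card_equation (h2 : (2 : F) ≠ 0) (W : WeierstrassCurve F) :
    Nat.card {p : F × F // W.toAffine.Equation p.1 p.2} = sqCount (psi W) :=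
  Nat.card_congr (equationEquiv h2 W)

theorem card_points [Finite F] (h2 : (2 : F) ≠ 0) (W : WeierstrassCurve F) [W.IsElliptic] :
    Nat.card W.toAffine.Point = sqCount (psi W) + 1 := by
  rw [Nat.card_congr (WeierstrassCurve.Affine.pointEquiv W.toAffine), ← card_equation h2]
  exact Finite.card_option

theorem two_zsmul_some_eq_zero_iff [DecidableEq F] {W : WeierstrassCurve F} {x y : F}
    (h : W.toAffine.Nonsingular x y) :
    (2 : ℤ) • WeierstrassCurve.Affine.Point.some x y h = 0 ↔ 2 * y + W.a₁ * x + W.a₃ = 0 := by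
  rw [two_zsmul, ← eq_neg_iff_add_eq_zero, WeierstrassCurve.Affine.Point.neg_some,
    WeierstrassCurve.Affine.Point.some.injEq, WeierstrassCurve.Affine.negY]
  constructor
  · rintro ⟨-, h⟩; linear_combination h
  · intro h; exact ⟨rfl, by linear_combination h⟩

/-- The nonzero rational two-torsion points are given by the rational zeros of `psi`. -/
noncomputable def torsionEquiv [DecidableEq F] (h2 : (2 : F) ≠ 0) (W : WeierstrassCurve F)
    [W.IsElliptic] :
    AddSubgroup.torsionBy W.toAffine.Point (2 : ℤ) ≃ Option {x : F // psi W x = 0} where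
  toFun P := match P with
    | ⟨.zero, _⟩ => none
    | ⟨.some x y h, hP⟩ => some ⟨x, by
        have h' := (two_zsmul_some_eq_zero_iff h).1 hP
        rw [← (equation_iff_psi h2 W x y).1 h.1, h', zero_pow two_ne_zero]⟩
  invFun x := match x with
    | none => ⟨0, zero_mem _⟩
    | some x =>
      have h : W.toAffine.Nonsingular x.1 ((-W.a₁ * x.1 - W.a₃) / 2) := by
        rw [← WeierstrassCurve.Affine.equation_iff_nonsingular, equation_iff_psi h2, x.2,
          mul_div_cancel₀ _ h2]
        ring
      ⟨.some _ _ h, (two_zsmul_some_eq_zero_iff h).2 (by rw [mul_div_cancel₀ _ h2]; ring)⟩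
  left_inv P := by
    rcases P with ⟨_ | ⟨x, y, h⟩, hP⟩
    · rfl
    · have h' := (two_zsmul_some_eq_zero_iff h).1 hP
      have : (-W.a₁ * x - W.a₃) / 2 = y := by
        rw [div_eq_iff h2]
        linear_combination -h'
      exact Subtype.ext (WeierstrassCurve.Affine.Point.some.injEq .. |>.mpr ⟨rfl, this⟩)
  right_inv x := by
    rcases x with _ | x <;> rfl

theorem card_torsion [Finite F] [DecidableEq F] (h2 : (2 : F) ≠ 0) (W : WeierstrassCurve F)
    [W.IsElliptic] : Nat.card (AddSubgroup.torsionBy W.toAffine.Point (2 : ℤ)) =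
      rootCount (psi W) + 1 := by
  rw [Nat.card_congr (torsionEquiv h2 W)]
  exact Finite.card_option

theorem hasFullTwoTorsion_iff [Finite F] [DecidableEq F] (h2 : (2 : F) ≠ 0) (E : EllipticCurve F) :
    E.HasFullTwoTorsion ↔ rootCount (psi E.1) = 3 := by
  have := E.2
  have hc := card_torsion h2 E.1
  constructor
  · rintro ⟨e⟩
    have h := Nat.card_congr e.toEquiv
    rw [Nat.card_prod, Nat.card_zmod, hc] at h
    omega
  · intro h
    rw [h] at hc
    have hfin : Finite (AddSubgroup.torsionBy E.1.toAffine.Point (2 : ℤ)) :=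
      Nat.finite_of_card_ne_zero (by rw [hc]; norm_num)
    have : IsAddKleinFour (AddSubgroup.torsionBy E.1.toAffine.Point (2 : ℤ)) := by
      refine ⟨hc, ?_⟩
      refine (Nat.dvd_prime Nat.prime_two).1 (AddMonoid.exponent_dvd_of_forall_nsmul_eq_zero ?_)
        |>.resolve_left ?_
      · rintro ⟨P, hP⟩
        ext
        have : (2 : ℤ) • P = 0 := hP
        rw [two_zsmul] at this
        exact (two_nsmul P).trans this
      · intro h1
        have hs := AddMonoid.exp_eq_one_iff.1 h1
        have := Finite.card_le_one_iff_subsingleton.2 hs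
        rw [hc] at this
        omega
    exact IsAddKleinFour.nonempty_addEquiv

end TwoTorsion

/-! ### The mass formula -/

section Mass

variable {F : Type*} [Field F]

/-- An admissible change of variables is given by its four parameters. -/
def variableChangeEquiv : WeierstrassCurve.VariableChange F ≃ Fˣ × F × F × F where
  toFun C := (C.u, C.r, C.s, C.t)
  invFun p := ⟨p.1, p.2.1, p.2.2.1, p.2.2.2⟩
  left_inv _ := rfl
  right_inv _ := rfl

theorem card_variableChange [Fintype F] :
    (Nat.card (WeierstrassCurve.VariableChange F) : ℚ) =
      ((Fintype.card F : ℚ) - 1) * (Fintype.card F : ℚ) ^ 3 := by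
  classical
  have h1 : 1 ≤ Fintype.card F := Fintype.card_pos
  rw [Nat.card_congr variableChangeEquiv, Nat.card_prod, Nat.card_prod, Nat.card_prod,
    Nat.card_eq_fintype_card (α := Fˣ), Fintype.card_units, Nat.card_eq_fintype_card]
  push_cast [h1]
  ring

theorem card_isoClass_mul_card_aut [Finite F] (c : IsoClass F) :
    Nat.card {E : EllipticCurve F // (⟦E⟧ : IsoClass F) = c} * Nat.card c.out.Aut =
      Nat.card (WeierstrassCurve.VariableChange F) := by
  have e : {E : EllipticCurve F // (⟦E⟧ : IsoClass F) = c} ≃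
      MulAction.orbit (WeierstrassCurve.VariableChange F) c.out.1 :=
    { toFun := fun E => ⟨E.1.1, by
        have h : E.1 ≈ c.out := Quotient.exact (E.2.trans (Quotient.out_eq c).symm)
        exact h⟩
      invFun := fun W => ⟨⟨W.1, by
        obtain ⟨g, hg⟩ := W.2
        have := c.out.2
        rw [← hg]
        change (g • c.out.1).IsElliptic
        infer_instance⟩, by
          conv_rhs => rw [← Quotient.out_eq c]
          exact Quotient.sound W.2⟩
      left_inv := fun _ => rfl
      right_inv := fun _ => rfl }
  rw [Nat.card_congr e, Nat.card_congr (MulAction.orbitEquivQuotientStabilizer _ _),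
    ← Subgroup.card_eq_card_quotient_mul_card_subgroup]

/-- The mass formula: a sum over isomorphism classes weighted by the reciprocals of the orders of
the automorphism groups counts Weierstrass equations, up to the number of changes of variables. -/
theorem sum_one_div_card_aut [Fintype F] (P : EllipticCurve F → Prop)
    (hP : ∀ E E' : EllipticCurve F, E ≈ E' → P E → P E') (s : Finset (IsoClass F))
    (hs : ∀ c : IsoClass F, c ∈ s ↔ P c.out) :
    (∑ c ∈ s, 1 / (Nat.card c.out.Aut : ℚ)) *
      (((Fintype.card F : ℚ) - 1) * (Fintype.card F : ℚ) ^ 3) =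
      Nat.card {E : EllipticCurve F // P E} := by
  classical
  have := Fintype.ofFinite (EllipticCurve F)
  have hterm : ∀ c : IsoClass F, 1 / (Nat.card c.out.Aut : ℚ) *
      (((Fintype.card F : ℚ) - 1) * (Fintype.card F : ℚ) ^ 3) =
      ((Finset.univ.filter fun E : EllipticCurve F => (⟦E⟧ : IsoClass F) = c).card : ℚ) := by
    intro c
    have h := card_isoClass_mul_card_aut c
    rw [Nat.card_eq_fintype_card (α := {E : EllipticCurve F // _}), Fintype.card_subtype] at h
    rw [← card_variableChange, ← h]
    have : Finite (WeierstrassCurve.VariableChange F) := Finite.of_equiv _ variableChangeEquiv.symm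
    have h0 : (Nat.card c.out.Aut : ℚ) ≠ 0 := Nat.cast_ne_zero.2 Nat.card_pos.ne'
    push_cast
    field_simp
  rw [Finset.sum_mul, Finset.sum_congr rfl fun c _ => hterm c, Nat.card_eq_fintype_card,
    Fintype.card_subtype, ← Nat.cast_sum, Nat.cast_inj,
    Finset.card_eq_sum_card_fiberwise (f := fun E : EllipticCurve F => (⟦E⟧ : IsoClass F))
      (t := s)]
  · refine Finset.sum_congr rfl fun c hc => congrArg _ ?_
    ext E
    simp only [Finset.mem_filter, Finset.mem_univ, true_and]
    refine ⟨fun h => ⟨?_, h⟩, fun h => h.2⟩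
    exact hP c.out E (Quotient.exact ((Quotient.out_eq c).trans h.symm)) ((hs c).1 hc)
  · intro E hE
    simp only [Finset.coe_filter, Finset.mem_univ, true_and, Set.mem_ofPred_eq] at hE
    exact (hs _).2 (hP E _ (Quotient.exact (Quotient.out_eq _).symm) hE)

theorem psi_variableChange (W : WeierstrassCurve F) (g : WeierstrassCurve.VariableChange F)
    (x : F) :
    psi W ((g.u : F) ^ 2 * x + g.r) = (g.u : F) ^ 6 * psi (g • W) x := by
  have hu : (g.u : F) ≠ 0 := g.u.ne_zero
  simp only [psi, WeierstrassCurve.variableChange_b₂, WeierstrassCurve.variableChange_b₄,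
    WeierstrassCurve.variableChange_b₆, Units.val_inv_eq_inv_val]
  field_simp
  ring

theorem sqCount_congr {f f' : F → F} (e : F ≃ F) {c : F} (hc : c ≠ 0)
    (h : ∀ x, f' (e x) = c ^ 2 * f x) : sqCount f' = sqCount f := by
  refine (Nat.card_congr ((e.prodCongr (Equiv.mulLeft₀ c hc)).subtypeEquiv fun p => ?_)).symm
  change p.2 ^ 2 = f p.1 ↔ (c * p.2) ^ 2 = f' (e p.1)
  rw [h, mul_pow]
  exact ((mul_right_injective₀ (pow_ne_zero 2 hc)).eq_iff).symm

theorem rootCount_congr {f f' : F → F} (e : F ≃ F) {c : F} (hc : c ≠ 0)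
    (h : ∀ x, f' (e x) = c * f x) : rootCount f' = rootCount f := by
  refine (Nat.card_congr (e.subtypeEquiv fun x => ?_)).symm
  rw [h, mul_eq_zero_iff_left hc]

/-- The affine map `x ↦ c x + d`. -/
def affineEquiv {c : F} (hc : c ≠ 0) (d : F) : F ≃ F :=
  (Equiv.mulLeft₀ c hc).trans (Equiv.addRight d)

theorem affineEquiv_apply {c : F} (hc : c ≠ 0) (d x : F) : affineEquiv hc d x = c * x + d := rfl

theorem sqCount_psi_variableChange (W : WeierstrassCurve F)
    (g : WeierstrassCurve.VariableChange F) :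
    sqCount (psi W) = sqCount (psi (g • W)) := by
  have hu : (g.u : F) ≠ 0 := g.u.ne_zero
  refine sqCount_congr (affineEquiv (pow_ne_zero 2 hu) g.r) (pow_ne_zero 3 hu) fun x => ?_
  rw [affineEquiv_apply, psi_variableChange]
  ring

theorem rootCount_psi_variableChange (W : WeierstrassCurve F)
    (g : WeierstrassCurve.VariableChange F) : rootCount (psi W) = rootCount (psi (g • W)) := by
  have hu : (g.u : F) ≠ 0 := g.u.ne_zero
  refine rootCount_congr (affineEquiv (pow_ne_zero 2 hu) g.r) (pow_ne_zero 6 hu) fun x => ?_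
  rw [affineEquiv_apply, psi_variableChange]

theorem invariants_eq_of_equiv {E E' : EllipticCurve F} (h : E ≈ E') :
    sqCount (psi E.1) = sqCount (psi E'.1) ∧ rootCount (psi E.1) = rootCount (psi E'.1) := by
  obtain ⟨g, hg⟩ := h
  have hg' : g • E'.1 = E.1 := hg
  rw [← hg']
  exact ⟨(sqCount_psi_variableChange _ _).symm, (rootCount_psi_variableChange _ _).symm⟩

variable [Fintype F]

/-- `N_A(t)` as a number of Weierstrass equations. -/
theorem weightedCount_mul (h2 : (2 : F) ≠ 0) (t : ℤ) :
    weightedCount F t * (((Fintype.card F : ℚ) - 1) * (Fintype.card F : ℚ) ^ 3) =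
      Nat.card {E : EllipticCurve F // (sqCount (psi E.1) : ℤ) = Fintype.card F - t} := by
  refine sum_one_div_card_aut _ (fun E E' h => ?_) _ fun c => ?_
  · rw [(invariants_eq_of_equiv h).1]; exact id
  · have := c.out.2
    rw [Finset.mem_filter, EllipticCurve.Points, card_points h2]
    simp only [Finset.mem_univ, true_and]
    push_cast
    omega

theorem weightedCountFull_mul [DecidableEq F] (h2 : (2 : F) ≠ 0) (t : ℤ) :
    weightedCountFull F t * (((Fintype.card F : ℚ) - 1) * (Fintype.card F : ℚ) ^ 3) =
      Nat.card {E : EllipticCurve F // (sqCount (psi E.1) : ℤ) = Fintype.card F - t ∧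
        rootCount (psi E.1) = 3} := by
  classical
  refine sum_one_div_card_aut _ (fun E E' h => ?_) _ fun c => ?_
  · rw [(invariants_eq_of_equiv h).1, (invariants_eq_of_equiv h).2]; exact id
  · have := c.out.2
    simp only [Finset.mem_filter]
    rw [EllipticCurve.Points, card_points h2, hasFullTwoTorsion_iff h2]
    simp only [Finset.mem_univ, true_and]
    push_cast
    refine and_congr_left fun _ => ?_
    omega

/-- Hasse's bound for an arbitrary Weierstrass equation. -/
theorem sq_sub_sqCount_psi_le (hF : ringChar F ≠ 2) (W : WeierstrassCurve F) [W.IsElliptic] :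
    ((Fintype.card F : ℤ) - sqCount (psi W)) ^ 2 ≤ 4 * Fintype.card F := by
  have h2 : (2 : F) ≠ 0 := Ring.two_ne_zero hF
  -- completing the square
  set g : WeierstrassCurve.VariableChange F := ⟨1, 0, -W.a₁ / 2, -W.a₃ / 2⟩
  have h₁ : (g • W).a₁ = 0 := by
    rw [WeierstrassCurve.variableChange_a₁, mul_div_cancel₀ _ h2]; simp
  have h₃ : (g • W).a₃ = 0 := by
    rw [WeierstrassCurve.variableChange_a₃, mul_div_cancel₀ _ h2]; simp [g]
  have h := sq_sub_sqCount_le hF (g • W) h₁ h₃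
  rw [sqCount_psi_variableChange W g]
  convert h using 3
  norm_cast
  refine sqCount_congr (Equiv.refl F) h2 fun x => ?_
  rw [eval_cubicPoly, Equiv.refl_apply, psi, WeierstrassCurve.b₂, WeierstrassCurve.b₄,
    WeierstrassCurve.b₆, h₁, h₃]
  ring

end Mass

end

section

open MvPolynomial

/-! ### Coefficients and values of quartic forms -/

section Coefficients

variable {F : Type*} [Field F]

/-- The exponent vector of `x^k y^(4-k)`. -/
noncomputable def expVec (k : Fin 5) : Fin 2 →₀ ℕ :=
  Finsupp.single 0 (k : ℕ) + Finsupp.single 1 (4 - (k : ℕ))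

theorem expVec_injective : Function.Injective expVec := by
  intro k l h
  have := DFunLike.congr_fun h 0
  simp [expVec] at this
  exact Fin.ext this

theorem exists_expVec {d : Fin 2 →₀ ℕ} (h : d.degree = 4) : ∃ k, d = expVec k := by
  have h' : d 0 + d 1 = 4 := by
    rw [← h, Finsupp.degree_eq_sum, Fin.sum_univ_two]
  refine ⟨⟨d 0, by omega⟩, ?_⟩
  ext i
  fin_cases i
  · simp [expVec]
  · simp [expVec]; omega

theorem degree_expVec (k : Fin 5) : (expVec k).degree = 4 := by
  rw [Finsupp.degree_eq_sum, Fin.sum_univ_two]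
  simp [expVec]
  omega

/-- The quartic form with coefficient `c k` at `x^k y^(4-k)`. -/
noncomputable def Quartic.mk (c : Fin 5 → F) : Quartic F :=
  ⟨∑ k, monomial (expVec k) (c k), Submodule.sum_mem _ fun k _ =>
    (mem_homogeneousSubmodule ..).2 (isHomogeneous_monomial _ (degree_expVec k))⟩

theorem Quartic.coeff_mk (c : Fin 5 → F) (k : Fin 5) :
    (Quartic.mk c : MvPolynomial (Fin 2) F).coeff (expVec k) = c k := by
  classical
  simp only [Quartic.mk, coeff_sum, coeff_monomial, expVec_injective.eq_iff]
  simp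

/-- A quartic form is given by its five coefficients. -/
noncomputable def Quartic.equivCoeff : Quartic F ≃ (Fin 5 → F) where
  toFun f k := (f : MvPolynomial (Fin 2) F).coeff (expVec k)
  invFun := Quartic.mk
  left_inv f := by
    ext d
    by_cases hd : d.degree = 4
    · obtain ⟨k, rfl⟩ := exists_expVec hd
      exact Quartic.coeff_mk _ k
    · rw [IsHomogeneous.coeff_eq_zero (Subtype.prop (Quartic.mk _)) hd,
        IsHomogeneous.coeff_eq_zero f.2 hd]
  right_inv c := funext fun k => Quartic.coeff_mk c k

instance [Finite F] : Finite (Quartic F) := Finite.of_equiv _ Quartic.equivCoeff.symm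

/-- The coefficient of `x^k y^(4-k)`. -/
noncomputable def Quartic.c (f : Quartic F) (k : Fin 5) : F := Quartic.equivCoeff f k

theorem Quartic.c_mk (c : Fin 5 → F) (k : Fin 5) : (Quartic.mk c).c k = c k := Quartic.coeff_mk c k

theorem Quartic.aeval_eq {K : Type*} [CommRing K] [Algebra F K] (f : Quartic F) (v : Fin 2 → K) :
    aeval v (f : MvPolynomial (Fin 2) F) = algebraMap F K (f.c 0) * v 1 ^ 4 +
      algebraMap F K (f.c 1) * v 0 * v 1 ^ 3 + algebraMap F K (f.c 2) * v 0 ^ 2 * v 1 ^ 2 +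
      algebraMap F K (f.c 3) * v 0 ^ 3 * v 1 + algebraMap F K (f.c 4) * v 0 ^ 4 := by
  have h : f = Quartic.mk f.c := (Quartic.equivCoeff.left_inv f).symm
  conv_lhs => rw [h]
  simp [Quartic.mk, Fin.sum_univ_five, aeval_monomial, expVec, Finsupp.prod_fintype, mul_assoc]

theorem Quartic.aeval_smul {K : Type*} [CommRing K] [Algebra F K] (f : Quartic F) (c : K)
    (v : Fin 2 → K) : aeval (c • v) (f : MvPolynomial (Fin 2) F) =
      c ^ 4 * aeval v (f : MvPolynomial (Fin 2) F) := by
  simp only [Quartic.aeval_eq, Pi.smul_apply, smul_eq_mul]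
  ring

/-- The value of `f` at a vector. -/
noncomputable def Quartic.val (f : Quartic F) (v : Fin 2 → F) : F :=
  eval v (f : MvPolynomial (Fin 2) F)

theorem Quartic.val_eq_aeval (f : Quartic F) (v : Fin 2 → F) :
    f.val v = aeval v (f : MvPolynomial (Fin 2) F) := rfl

theorem Quartic.val_smul (f : Quartic F) (c : F) (v : Fin 2 → F) :
    f.val (c • v) = c ^ 4 * f.val v := Quartic.aeval_smul f c v

/-- The polynomial function `f(x, 1)`. -/
noncomputable def Quartic.aff (f : Quartic F) (x : F) : F := f.val ![x, 1]

theorem Quartic.aff_eq (f : Quartic F) (x : F) :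
    f.aff x = f.c 0 + f.c 1 * x + f.c 2 * x ^ 2 + f.c 3 * x ^ 3 + f.c 4 * x ^ 4 := by
  rw [Quartic.aff, Quartic.val_eq_aeval, Quartic.aeval_eq]
  simp

theorem Quartic.val_e1 (f : Quartic F) : f.val ![1, 0] = f.c 4 := by
  rw [Quartic.val_eq_aeval, Quartic.aeval_eq]
  simp

end Coefficients

/-! ### Linear substitutions -/

section Substitution

variable {F : Type*} [Field F]

/-- The linear substitution of variables given by a matrix. -/
noncomputable def Quartic.subst (M : Matrix (Fin 2) (Fin 2) F) (f : Quartic F) : Quartic F :=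
  ⟨bind₁ (fun i => ∑ j, C (M i j) * X j) (f : MvPolynomial (Fin 2) F), by
    have h : IsHomogeneous (f : MvPolynomial (Fin 2) F) 4 := f.2
    have := h.aeval (fun i => ∑ j, C (M i j) * X j) (n := 1)
      (fun i => IsHomogeneous.sum _ _ _ fun j _ => isHomogeneous_C_mul_X _ _)
    exact this⟩

theorem Quartic.aeval_subst {K : Type*} [CommRing K] [Algebra F K] (M : Matrix (Fin 2) (Fin 2) F)
    (f : Quartic F) (v : Fin 2 → K) :
    aeval v (f.subst M : MvPolynomial (Fin 2) F) =
      aeval ((M.map (algebraMap F K)).mulVec v) (f : MvPolynomial (Fin 2) F) := by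
  rw [Quartic.subst, aeval_bind₁]
  congr 2
  ext i
  simp [Matrix.mulVec, dotProduct]

theorem Quartic.val_subst (M : Matrix (Fin 2) (Fin 2) F) (f : Quartic F) (v : Fin 2 → F) :
    (f.subst M).val v = f.val (M.mulVec v) := Quartic.aeval_subst M f v

theorem Quartic.subst_subst (M N : Matrix (Fin 2) (Fin 2) F) (f : Quartic F) :
    (f.subst M).subst N = f.subst (M * N) := by
  apply Subtype.ext
  change bind₁ _ (bind₁ _ _) = bind₁ _ _
  rw [bind₁_bind₁]
  congr 2
  ext1 i
  simp [Matrix.mul_apply]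
  ring

theorem Quartic.subst_one (f : Quartic F) : f.subst 1 = f := by
  apply Subtype.ext
  change bind₁ _ _ = _
  have : (fun i : Fin 2 => ∑ j, C ((1 : Matrix (Fin 2) (Fin 2) F) i j) * X j) =
      (X : Fin 2 → MvPolynomial (Fin 2) F) := by
    ext1 i
    rw [Fin.sum_univ_two]
    fin_cases i <;> simp [Matrix.one_apply]
  rw [this, bind₁_X_left]
  rfl

/-- Substitution by an invertible matrix as a permutation of the quartic forms. -/
noncomputable def Quartic.substEquiv (g : GL (Fin 2) F) : Quartic F ≃ Quartic F where
  toFun := Quartic.subst g.1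
  invFun := Quartic.subst g⁻¹.1
  left_inv f := by
    rw [Quartic.subst_subst, ← Units.val_mul, mul_inv_cancel, Units.val_one, subst_one]
  right_inv f := by
    rw [Quartic.subst_subst, ← Units.val_mul, inv_mul_cancel, Units.val_one, subst_one]

theorem exists_mulVec_eq {v : Fin 2 → F} (hv : v ≠ 0) :
    ∃ g : GL (Fin 2) F, g.1.mulVec ![1, 0] = v := by
  by_cases h0 : v 0 = 0
  · have h1 : v 1 ≠ 0 := fun h1 => hv (by ext i; fin_cases i <;> assumption)
    refine ⟨Matrix.GeneralLinearGroup.mkOfDetNeZero !![0, 1; v 1, 0] (by simpa using h1), ?_⟩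
    ext i
    fin_cases i <;> simp [Matrix.GeneralLinearGroup.mkOfDetNeZero, h0]
  · refine ⟨Matrix.GeneralLinearGroup.mkOfDetNeZero !![v 0, 0; v 1, 1] (by simpa using h0), ?_⟩
    ext i
    fin_cases i <;> simp [Matrix.GeneralLinearGroup.mkOfDetNeZero]

/-- The linear automorphism of `K²` given by an invertible matrix over `F`. -/
noncomputable def linEquiv (K : Type*) [Field K] [Algebra F K] (g : GL (Fin 2) F) :
    (Fin 2 → K) ≃ₗ[K] (Fin 2 → K) :=
  Matrix.toLin'OfInv (M := g⁻¹.1.map (algebraMap F K)) (M' := g.1.map (algebraMap F K))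
    (by rw [← Matrix.map_mul, ← Units.val_mul, inv_mul_cancel, Units.val_one,
      Matrix.map_one _ (map_zero _) (map_one _)])
    (by rw [← Matrix.map_mul, ← Units.val_mul, mul_inv_cancel, Units.val_one,
      Matrix.map_one _ (map_zero _) (map_one _)])

theorem linEquiv_apply {K : Type*} [Field K] [Algebra F K] (g : GL (Fin 2) F) (v : Fin 2 → K) :
    linEquiv K g v = (g.1.map (algebraMap F K)).mulVec v := by
  rw [← Matrix.toLin'_apply]
  rfl

/-- The permutation of the projective line induced by a linear automorphism. -/
noncomputable def projEquiv {K : Type*} [Field K] (e : (Fin 2 → K) ≃ₗ[K] (Fin 2 → K)) :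
    Projectivization K (Fin 2 → K) ≃ Projectivization K (Fin 2 → K) :=
  Equiv.ofBijective (Projectivization.map e.toLinearMap e.injective)
    ⟨Projectivization.map_injective _ e.injective, fun P => by
      refine ⟨Projectivization.map e.symm.toLinearMap e.symm.injective P, ?_⟩
      induction P using Projectivization.ind with | h v hv =>
      rw [Projectivization.map_mk, Projectivization.map_mk]
      congr 1
      exact e.apply_symm_apply v⟩

theorem exists_smul_rep_projEquiv {K : Type*} [Field K] (e : (Fin 2 → K) ≃ₗ[K] (Fin 2 → K))
    (P : Projectivization K (Fin 2 → K)) :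
    ∃ a : Kˣ, e P.rep = (a : K) • (projEquiv e P).rep := by
  have h0 : e P.rep ≠ 0 := fun h => P.rep_nonzero (e.map_eq_zero_iff.1 h)
  have h : projEquiv e P = Projectivization.mk K (e P.rep) h0 := by
    conv_lhs => rw [← P.mk_rep]
    rfl
  obtain ⟨a, ha⟩ := Projectivization.exists_smul_eq_mk_rep K (e P.rep) h0
  refine ⟨a⁻¹, ?_⟩
  rw [h, ← ha, Units.smul_def, smul_smul, Units.inv_mul, one_smul]

end Substitution

/-! ### Double counting over the projective line -/

section ProjectiveSums

variable {F : Type*} [Field F]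

theorem exists_rep_mk {K : Type*} [Field K] {v : Fin 2 → K} (hv : v ≠ 0) :
    ∃ a : K, a ≠ 0 ∧ (Projectivization.mk K v hv).rep = a • v := by
  obtain ⟨a, ha⟩ := Projectivization.exists_smul_eq_mk_rep K v hv
  exact ⟨a, a.ne_zero, ha.symm⟩

noncomputable instance [Finite F] : Fintype (Projectivization F (Fin 2 → F)) :=
  Fintype.ofFinite _

theorem card_proj [Fintype F] :
    Fintype.card (Projectivization F (Fin 2 → F)) = Fintype.card F + 1 := by
  rw [← Nat.card_eq_fintype_card, Projectivization.card_of_finrank_two F _ (by simp),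
    Nat.card_eq_fintype_card]

/-- The sum of `φ (f(P))` over the points of the projective line, the value `f(P)` being well
defined up to a nonzero fourth power. -/
noncomputable def projSum [Fintype F] (φ : F → ℕ) (f : Quartic F) : ℕ :=
  ∑ P : Projectivization F (Fin 2 → F), φ (f.val P.rep)

/-- `φ` takes the same value at elements that differ by a nonzero fourth power. -/
def FourthPowerInvariant (φ : F → ℕ) : Prop := ∀ c a, c ≠ 0 → φ (c ^ 4 * a) = φ a

theorem fourthPowerInvariant_zero [DecidableEq F] :
    FourthPowerInvariant (fun a : F => if a = 0 then 1 else 0) := by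
  intro c a hc
  simp [hc]

theorem card_sqrts_mul {c : F} (hc : c ≠ 0) (a : F) :
    Nat.card {w : F // w ^ 2 = c ^ 2 * a} = Nat.card {w : F // w ^ 2 = a} := by
  refine (Nat.card_congr ((Equiv.mulLeft₀ c hc).subtypeEquiv fun w => ?_)).symm
  change w ^ 2 = a ↔ (c * w) ^ 2 = c ^ 2 * a
  rw [mul_pow]
  exact ((mul_right_injective₀ (pow_ne_zero 2 hc)).eq_iff).symm

theorem fourthPowerInvariant_sqrts :
    FourthPowerInvariant (fun a : F => Nat.card {w : F // w ^ 2 = a}) := by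
  intro c a hc
  have := card_sqrts_mul (pow_ne_zero 2 hc) a
  rwa [← pow_mul] at this

variable [Fintype F] {φ : F → ℕ}

theorem projSum_eq (hφ : FourthPowerInvariant φ) (f : Quartic F) :
    projSum φ f = φ (f.c 4) + ∑ x, φ (f.aff x) := by
  classical
  let e : Option F ≃ Projectivization F (Fin 2 → F) := OnePoint.equivProjectivization F
  rw [projSum, ← Equiv.sum_comp e fun P => φ (f.val P.rep), Fintype.sum_option]
  have key : ∀ {v : Fin 2 → F} (hv : v ≠ 0), φ (f.val (Projectivization.mk F v hv).rep) =
      φ (f.val v) := by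
    intro v hv
    obtain ⟨a, ha, h⟩ := exists_rep_mk hv
    rw [h, Quartic.val_smul, hφ _ _ ha]
  congr 1
  · exact (key _).trans (by rw [Quartic.val_e1])
  · exact Finset.sum_congr rfl fun x _ => key _

theorem projSum_subst (hφ : FourthPowerInvariant φ) (g : GL (Fin 2) F) (f : Quartic F) :
    projSum φ (f.subst g.1) = projSum φ f := by
  rw [projSum, projSum, ← Equiv.sum_comp (projEquiv (linEquiv F g)) fun P => φ (f.val P.rep)]
  refine Finset.sum_congr rfl fun P _ => ?_
  obtain ⟨a, ha⟩ := exists_smul_rep_projEquiv (linEquiv F g) P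
  rw [linEquiv_apply] at ha
  rw [Quartic.val_subst]
  change φ (f.val ((g.1.map id).mulVec P.rep)) = _
  change (g.1.map id).mulVec P.rep = _ at ha
  rw [ha, Quartic.val_smul, hφ _ _ a.ne_zero]

/-- Double counting over the points of the projective line: for a set of forms stable under
substitutions all points contribute equally. -/
theorem sum_projSum (S : Finset (Quartic F))
    (hS : ∀ (g : GL (Fin 2) F) (f : Quartic F), f ∈ S → f.subst g.1 ∈ S) :
    ∑ f ∈ S, projSum φ f = (Fintype.card F + 1) * ∑ f ∈ S, φ (f.c 4) := by
  simp only [projSum]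
  rw [Finset.sum_comm, Finset.sum_congr rfl (g := fun _ => ∑ f ∈ S, φ (f.c 4)) ?_, Finset.sum_const,
    Finset.card_univ, card_proj, smul_eq_mul]
  intro P _
  obtain ⟨g, hg⟩ := exists_mulVec_eq P.rep_nonzero
  refine Finset.sum_bij' (fun f _ => Quartic.substEquiv g f)
    (fun f _ => (Quartic.substEquiv g).symm f) (fun f hf => hS g f hf) (fun f hf => hS g⁻¹ f hf)
    (by simp) (by simp) fun f _ => ?_
  rw [← Quartic.val_e1]
  change _ = φ ((f.subst g.1).val _)
  rw [Quartic.val_subst, hg]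

theorem ncard_roots [DecidableEq F] (f : Quartic F) :
    (f.roots F).ncard = projSum (fun a => if a = 0 then 1 else 0) f := by
  classical
  rw [projSum, ← Finset.card_filter, ← Set.ncard_coe_finset]
  congr 1
  ext P
  simp only [Finset.coe_filter, Finset.mem_univ, true_and]
  exact Iff.rfl

theorem ncard_curvePoints (f : Quartic F) :
    f.curvePoints.ncard = projSum (fun a => Nat.card {w : F // w ^ 2 = a}) f := by
  rw [projSum, ← Nat.card_sigma, ← Nat.card_coe_set_eq]
  have e : f.curvePoints = {Q | Q.2 ^ 2 = f.val Q.1.rep} := rfl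
  rw [e]
  exact Nat.card_congr (Equiv.subtypeProdEquivSigmaSubtype
    fun (P : Projectivization F (Fin 2 → F)) (w : F) => w ^ 2 = f.val P.rep)

theorem ncard_roots_eq [DecidableEq F] (f : Quartic F) :
    (f.roots F).ncard = (if f.c 4 = 0 then 1 else 0) + rootCount f.aff := by
  rw [ncard_roots, projSum_eq fourthPowerInvariant_zero, rootCount, Nat.card_eq_fintype_card,
    Fintype.card_subtype, Finset.card_filter]

theorem ncard_curvePoints_eq (f : Quartic F) :
    f.curvePoints.ncard = Nat.card {w : F // w ^ 2 = f.c 4} + sqCount f.aff := by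
  rw [ncard_curvePoints, projSum_eq fourthPowerInvariant_sqrts, sqCount_eq_sum]

theorem ncard_roots_subst (g : GL (Fin 2) F) (f : Quartic F) :
    ((f.subst g.1).roots F).ncard = (f.roots F).ncard := by
  classical
  rw [ncard_roots, ncard_roots, projSum_subst fourthPowerInvariant_zero]

theorem ncard_curvePoints_subst (g : GL (Fin 2) F) (f : Quartic F) :
    (f.subst g.1).curvePoints.ncard = f.curvePoints.ncard := by
  rw [ncard_curvePoints, ncard_curvePoints, projSum_subst fourthPowerInvariant_sqrts]

end ProjectiveSums

/-! ### Roots over an extension field -/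

section DistinctRoots

variable {F : Type*} [Field F]

theorem Quartic.roots_subst (K : Type*) [Field K] [Algebra F K] (g : GL (Fin 2) F) (f : Quartic F) :
    (f.subst g.1).roots K = projEquiv (linEquiv K g) ⁻¹' f.roots K := by
  ext P
  obtain ⟨a, ha⟩ := exists_smul_rep_projEquiv (linEquiv K g) P
  rw [linEquiv_apply] at ha
  change aeval P.rep (f.subst g.1 : MvPolynomial (Fin 2) F) = 0 ↔
    aeval (projEquiv (linEquiv K g) P).rep (f : MvPolynomial (Fin 2) F) = 0
  rw [Quartic.aeval_subst, ha, Quartic.aeval_smul, mul_eq_zero_iff_left (pow_ne_zero 4 a.ne_zero)]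

theorem Quartic.hasDistinctRoots_subst (g : GL (Fin 2) F) (f : Quartic F) :
    (f.subst g.1).HasDistinctRoots ↔ f.HasDistinctRoots := by
  rw [Quartic.HasDistinctRoots, Quartic.HasDistinctRoots, Quartic.roots_subst,
    Set.ncard_preimage_of_injective_subset_range (Equiv.injective _) (by simp)]

open Classical in
theorem Quartic.encard_roots (K : Type*) [Field K] [Algebra F K] (f : Quartic F) :
    (f.roots K).encard = (if f.c 4 = 0 then 1 else 0) +
      {x : K | aeval ![x, 1] (f : MvPolynomial (Fin 2) F) = 0}.encard := by
  have key : ∀ {v : Fin 2 → K} (hv : v ≠ 0), Projectivization.mk K v hv ∈ f.roots K ↔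
      aeval v (f : MvPolynomial (Fin 2) F) = 0 := by
    intro v hv
    obtain ⟨a, ha, h⟩ := exists_rep_mk hv
    change aeval (Projectivization.mk K v hv).rep (f : MvPolynomial (Fin 2) F) = 0 ↔ _
    rw [h, Quartic.aeval_smul, mul_eq_zero_iff_left (pow_ne_zero 4 ha)]
  set s : Set (Option K) := OnePoint.equivProjectivization K ⁻¹' f.roots K
  have hs : s.encard = (f.roots K).encard :=
    Set.encard_preimage_of_bijective (Equiv.bijective _) _
  have hsome : ∀ x : K, some x ∈ s ↔ aeval ![x, 1] (f : MvPolynomial (Fin 2) F) = 0 :=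
    fun x => key _
  have hnone : none ∈ s ↔ f.c 4 = 0 := by
    refine (key _).trans ?_
    rw [Quartic.aeval_eq]
    simp
  have hs' : s = (if f.c 4 = 0 then {none} else ∅) ∪
      some '' {x : K | aeval ![x, 1] (f : MvPolynomial (Fin 2) F) = 0} := by
    ext x
    rcases x with _ | x
    · rw [hnone]
      split_ifs with h <;> simp [h]
    · rw [hsome]
      split_ifs with h <;> simp
  rw [← hs, hs', Set.encard_union_eq, (Option.some_injective K).encard_image]
  · split_ifs <;> simp
  · rw [Set.disjoint_left]
    rintro x hx ⟨y, -, rfl⟩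
    split_ifs at hx <;> simp at hx

open Classical in
theorem Quartic.hasDistinctRoots_iff (f : Quartic F) : f.HasDistinctRoots ↔
    (if f.c 4 = 0 then 1 else 0) + {x : AlgebraicClosure F |
      aeval ![x, 1] (f : MvPolynomial (Fin 2) F) = 0}.encard = (4 : ℕ∞) := by
  rw [Quartic.HasDistinctRoots, ← Quartic.encard_roots, Set.ncard, ENat.toNat_eq_iff (by norm_num)]
  rfl

end DistinctRoots

end

section

open Polynomial

/-! ### Discriminants -/

section RootsOfPolynomials

theorem encard_roots_eq_iff {K : Type*} [Field K] [IsAlgClosed K] {p : K[X]} {n : ℕ}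
    (hn : p.natDegree ≤ n) :
    {x : K | p.eval x = 0}.encard = n ↔ p ≠ 0 ∧ p.natDegree = n ∧ p.roots.Nodup := by
  classical
  rcases eq_or_ne p 0 with rfl | hp
  · have : Infinite K := IsAlgClosed.instInfinite
    simp [Set.encard_eq_top_iff.2 Set.infinite_univ]
  · have hs : {x : K | p.eval x = 0} = (p.roots.toFinset : Set K) := by
      ext x
      simp [hp]
    have hc : p.roots.card = p.natDegree := IsAlgClosed.card_roots_eq_natDegree
    rw [hs, Set.encard_coe_eq_coe_finsetCard, Nat.cast_inj]
    have hle := Multiset.toFinset_card_le p.roots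
    refine ⟨fun h => ⟨hp, by omega, ?_⟩, fun h => ?_⟩
    · rw [← Multiset.toFinset_card_eq_card_iff_nodup]
      omega
    · rw [Multiset.toFinset_card_of_nodup h.2.2, hc, h.2.1]

end RootsOfPolynomials

section Smoothness

variable {F : Type*} [Field F]

/-- The polynomial `f(X, 1)`. -/
noncomputable def Quartic.poly (f : Quartic F) : F[X] :=
  C (f.c 0) + C (f.c 1) * X + C (f.c 2) * X ^ 2 + C (f.c 3) * X ^ 3 + C (f.c 4) * X ^ 4

theorem Quartic.coeff_poly (f : Quartic F) (k : Fin 5) : f.poly.coeff k = f.c k := by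
  fin_cases k <;> simp [Quartic.poly, coeff_X, coeff_C]

theorem Quartic.eval_map_poly {K : Type*} [Field K] [Algebra F K] (f : Quartic F) (x : K) :
    (f.poly.map (algebraMap F K)).eval x =
      MvPolynomial.aeval ![x, 1] (f : MvPolynomial (Fin 2) F) := by
  rw [Quartic.aeval_eq]
  simp [Quartic.poly]

open Classical in
theorem Quartic.hasDistinctRoots_iff_poly (f : Quartic F) : f.HasDistinctRoots ↔
    {x : AlgebraicClosure F | (f.poly.map (algebraMap F (AlgebraicClosure F))).eval x = 0}.encard =
      ((if f.c 4 = 0 then 3 else 4 : ℕ) : ℕ∞) := by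
  rw [Quartic.hasDistinctRoots_iff]
  simp_rw [Quartic.eval_map_poly]
  split_ifs with h
  · have : (4 : ℕ∞) = 1 + (3 : ℕ) := by norm_num
    rw [this]
    exact WithTop.add_left_inj ENat.one_ne_top
  · rw [zero_add]
    rfl

theorem Quartic.poly_eq_cubic {f : Quartic F} (h : f.c 4 = 0) :
    f.poly = Cubic.toPoly ⟨f.c 3, f.c 2, f.c 1, f.c 0⟩ := by
  rw [Quartic.poly, Cubic.toPoly, h]
  simp
  ring

theorem Quartic.hasDistinctRoots_iff_of_c4_eq_zero {f : Quartic F} (h : f.c 4 = 0) :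
    f.HasDistinctRoots ↔
      f.c 3 ≠ 0 ∧ (Cubic.discr (⟨f.c 3, f.c 2, f.c 1, f.c 0⟩ : Cubic F)) ≠ 0 := by
  set P : Cubic F := ⟨f.c 3, f.c 2, f.c 1, f.c 0⟩
  set φ := algebraMap F (AlgebraicClosure F)
  have hpoly : f.poly.map φ = (P.map φ).toPoly := by
    rw [Quartic.poly_eq_cubic h, Cubic.map_toPoly]
  rw [Quartic.hasDistinctRoots_iff_poly, if_pos h, encard_roots_eq_iff]
  · by_cases h3 : f.c 3 = 0
    · refine iff_of_false (fun hh => ?_) (fun hh => hh.1 h3)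
      have := hh.2.1
      rw [hpoly] at this
      have := Cubic.natDegree_of_a_eq_zero (P := P.map φ) (by simp [P, Cubic.map, h3])
      omega
    · have ha : P.a ≠ 0 := h3
      have ha' : (P.map φ).a ≠ 0 := by simpa [Cubic.map] using ha
      rw [Cubic.discr_ne_zero_iff_roots_nodup ha (IsAlgClosed.splits (P.toPoly.map φ)), Cubic.roots,
        hpoly]
      refine ⟨fun hh => ⟨h3, hh.2.2⟩, fun hh => ⟨?_, ?_, hh.2⟩⟩
      · exact Cubic.ne_zero_of_a_ne_zero ha'
      · exact Cubic.natDegree_of_a_ne_zero ha'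
  · rw [hpoly]
    exact natDegree_cubic_le

/-- The monic quartic form attached to a Weierstrass equation with `a₆ = 0`: the discriminant of
the quadratic equation for the `x`-coordinates of the points other than `(0, 0)` on the line
`y = m x`. -/
noncomputable def monicForm (W : WeierstrassCurve F) : Quartic F :=
  Quartic.mk ![W.a₂ ^ 2 - 4 * W.a₄, 4 * W.a₃ - 2 * W.a₁ * W.a₂, W.a₁ ^ 2 - 2 * W.a₂, 2 * W.a₁, 1]

theorem monicForm_aff (W : WeierstrassCurve F) (m : F) :
    (monicForm W).aff m = (m ^ 2 + W.a₁ * m - W.a₂) ^ 2 - 4 * (W.a₄ - W.a₃ * m) := by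
  rw [Quartic.aff_eq]
  simp [monicForm, Quartic.c_mk]
  ring

theorem Quartic.natDegree_poly {f : Quartic F} (h : f.c 4 ≠ 0) : f.poly.natDegree = 4 := by
  rw [Quartic.poly]
  compute_degree!

theorem Quartic.monic_poly {f : Quartic F} (h : f.c 4 = 1) : f.poly.Monic := by
  rw [Monic, leadingCoeff, Quartic.natDegree_poly (by simp [h])]
  exact (f.coeff_poly 4).trans h

theorem coeff_monic_quartic {R : Type*} [CommRing R] (b c d e : R) (k : Fin 5) :
    (X ^ 4 + C b * X ^ 3 + C c * X ^ 2 + C d * X + C e : R[X]).coeff k = ![e, d, c, b, 1] k := by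
  fin_cases k <;> simp [coeff_X, coeff_C, coeff_X_pow]

/-- The discriminant of a monic quartic polynomial in terms of its coefficients. -/
theorem discr_quartic {R : Type*} [CommRing R] {r₁ r₂ r₃ r₄ b c d e : R}
    (hb : b = -(r₁ + r₂ + r₃ + r₄))
    (hc : c = r₁ * r₂ + r₁ * r₃ + r₁ * r₄ + r₂ * r₃ + r₂ * r₄ + r₃ * r₄)
    (hd : d = -(r₁ * r₂ * r₃ + r₁ * r₂ * r₄ + r₁ * r₃ * r₄ + r₂ * r₃ * r₄))
    (he : e = r₁ * r₂ * r₃ * r₄) :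
    ((r₁ - r₂) * (r₁ - r₃) * (r₁ - r₄) * (r₂ - r₃) * (r₂ - r₄) * (r₃ - r₄)) ^ 2 =
      256 * e ^ 3 - 192 * b * d * e ^ 2 - 128 * c ^ 2 * e ^ 2 + 144 * c * d ^ 2 * e - 27 * d ^ 4 +
      144 * b ^ 2 * c * e ^ 2 - 6 * b ^ 2 * d ^ 2 * e - 80 * b * c ^ 2 * d * e +
      18 * b * c * d ^ 3 + 16 * c ^ 4 * e - 4 * c ^ 3 * d ^ 2 - 27 * b ^ 4 * e ^ 2 +
      18 * b ^ 3 * c * d * e - 4 * b ^ 3 * d ^ 3 - 4 * b ^ 2 * c ^ 3 * e +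
      b ^ 2 * c ^ 2 * d ^ 2 := by
  subst hb hc hd he
  ring

/-- The discriminant of `monicForm W` is `2⁸ Δ`. -/
theorem monicForm_hasDistinctRoots_iff (h2 : (2 : F) ≠ 0) {W : WeierstrassCurve F}
    (h6 : W.a₆ = 0) : (monicForm W).HasDistinctRoots ↔ W.Δ ≠ 0 := by
  set K := AlgebraicClosure F
  set φ := algebraMap F K
  have hc4 : (monicForm W).c 4 = 1 := by simp [monicForm, Quartic.c_mk]
  have hm : ((monicForm W).poly.map φ).Monic := (Quartic.monic_poly hc4).map φ
  have hd : ((monicForm W).poly.map φ).natDegree = 4 := by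
    rw [natDegree_map, Quartic.natDegree_poly (by simp [hc4])]
  rw [Quartic.hasDistinctRoots_iff_poly, if_neg (by simp [hc4]), encard_roots_eq_iff hd.le]
  have hcard : ((monicForm W).poly.map φ).roots.card = 4 := by
    rw [IsAlgClosed.card_roots_eq_natDegree, hd]
  obtain ⟨r₁, r₂, r₃, r₄, hr⟩ := Multiset.card_eq_four.1 hcard
  have hprod := (IsAlgClosed.splits ((monicForm W).poly.map φ)).eq_prod_roots_of_monic hm
  rw [hr] at hprod
  simp only [Multiset.insert_eq_cons, Multiset.map_cons, Multiset.map_singleton,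
    Multiset.prod_cons, Multiset.prod_singleton] at hprod
  have hexp : (X - C r₁) * ((X - C r₂) * ((X - C r₃) * (X - C r₄))) =
      X ^ 4 + C (-(r₁ + r₂ + r₃ + r₄)) * X ^ 3 +
      C (r₁ * r₂ + r₁ * r₃ + r₁ * r₄ + r₂ * r₃ + r₂ * r₄ + r₃ * r₄) * X ^ 2 +
      C (-(r₁ * r₂ * r₃ + r₁ * r₂ * r₄ + r₁ * r₃ * r₄ + r₂ * r₃ * r₄)) * X +
      C (r₁ * r₂ * r₃ * r₄) := by
    simp only [map_add, map_mul, map_neg]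
    ring
  rw [hexp] at hprod
  have key : ∀ k : Fin 5, φ ((monicForm W).c k) = _ := fun k => by
    rw [← Quartic.coeff_poly, ← coeff_map, hprod, coeff_monic_quartic]
  have hdisc := discr_quartic (key 3) (key 2) (key 1) (key 0)
  have hΔ : ((r₁ - r₂) * (r₁ - r₃) * (r₁ - r₄) * (r₂ - r₃) * (r₂ - r₄) * (r₃ - r₄)) ^ 2 =
      φ (2 ^ 8 * W.Δ) := by
    rw [hdisc]
    simp only [← map_ofNat φ, ← map_mul, ← map_pow, ← map_sub, ← map_add]
    congr 1
    simp only [monicForm, Quartic.c_mk, WeierstrassCurve.Δ, WeierstrassCurve.b₂,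
      WeierstrassCurve.b₄, WeierstrassCurve.b₆, WeierstrassCurve.b₈, h6, Matrix.cons_val]
    ring
  clear hdisc key hprod hexp
  have hne : (r₁ - r₂) * (r₁ - r₃) * (r₁ - r₄) * (r₂ - r₃) * (r₂ - r₄) * (r₃ - r₄) ≠ 0 ↔
      W.Δ ≠ 0 := by
    rw [← pow_ne_zero_iff two_ne_zero, hΔ, _root_.map_ne_zero, mul_ne_zero_iff_left]
    exact pow_ne_zero 8 h2
  rw [← hne, hr]
  have h0 : (monicForm W).poly.map φ ≠ 0 := hm.ne_zero
  simp only [ne_eq, mul_eq_zero, sub_eq_zero, h0, hd, Multiset.insert_eq_cons,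
    Multiset.nodup_cons, Multiset.mem_cons, Multiset.mem_singleton, Multiset.nodup_singleton]
  tauto

end Smoothness

/-! ### Forms with a root at infinity -/

section CubicForms

variable {F : Type*} [Field F]

theorem Quartic.ext_c {f g : Quartic F} (h : ∀ k, f.c k = g.c k) : f = g :=
  Quartic.equivCoeff.injective (funext h)

theorem isElliptic_iff_Δ_ne_zero {W : WeierstrassCurve F} : W.IsElliptic ↔ W.Δ ≠ 0 := by
  rw [WeierstrassCurve.isElliptic_iff, isUnit_iff_ne_zero]

/-- The quartic form with a root at infinity and leading coefficient `u` attached to a Weierstrass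
equation: its value at `4 z / u` is `(4 / u)² (4 z³ + b₂ z² + 2 b₄ z + b₆)`. -/
noncomputable def cubicForm (W : WeierstrassCurve F) (u : F) : Quartic F :=
  Quartic.mk ![16 * W.b₆ / u ^ 2, 8 * W.b₄ / u, W.b₂, u, 0]

theorem cubicForm_aff (W : WeierstrassCurve F) {u : F} (hu : u ≠ 0) (z : F) :
    (cubicForm W u).aff (4 / u * z) = (4 / u) ^ 2 * psi W z := by
  simp only [Quartic.aff_eq, cubicForm, Quartic.c_mk, psi, Matrix.cons_val]
  field_simp
  ring

variable (h2 : (2 : F) ≠ 0)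
include h2

theorem four_ne_zero_of_two : (4 : F) ≠ 0 := by
  have := mul_ne_zero h2 h2
  norm_num at this
  exact this

theorem sqCount_cubicForm (W : WeierstrassCurve F) {u : F} (hu : u ≠ 0) :
    sqCount (cubicForm W u).aff = sqCount (psi W) := by
  have hc : 4 / u ≠ 0 := div_ne_zero (four_ne_zero_of_two h2) hu
  refine sqCount_congr (affineEquiv hc 0) hc fun z => ?_
  rw [affineEquiv_apply, add_zero, cubicForm_aff W hu]

theorem rootCount_cubicForm (W : WeierstrassCurve F) {u : F} (hu : u ≠ 0) :
    rootCount (cubicForm W u).aff = rootCount (psi W) := by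
  have hc : 4 / u ≠ 0 := div_ne_zero (four_ne_zero_of_two h2) hu
  refine rootCount_congr (affineEquiv hc 0) (pow_ne_zero 2 hc) fun z => ?_
  rw [affineEquiv_apply, add_zero, cubicForm_aff W hu]

/-- Up to a nonzero factor, the cubic form has the discriminant of the two-torsion polynomial. -/
theorem cubicForm_hasDistinctRoots_iff (W : WeierstrassCurve F) {u : F} (hu : u ≠ 0) :
    (cubicForm W u).HasDistinctRoots ↔ W.Δ ≠ 0 := by
  have h4 := four_ne_zero_of_two h2
  have hd : Cubic.discr (⟨(cubicForm W u).c 3, (cubicForm W u).c 2, (cubicForm W u).c 1,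
      (cubicForm W u).c 0⟩ : Cubic F) = (4 / u) ^ 2 * (4 ^ 2 * W.Δ) := by
    have h := W.twoTorsionPolynomial_discr
    have : (4 : F) ^ 2 * W.Δ = W.twoTorsionPolynomial.discr := by rw [h]; norm_num
    rw [this]
    simp only [Cubic.discr, cubicForm, Quartic.c_mk, WeierstrassCurve.twoTorsionPolynomial,
      Matrix.cons_val]
    field_simp
    ring
  rw [Quartic.hasDistinctRoots_iff_of_c4_eq_zero (by simp [cubicForm, Quartic.c_mk]), hd]
  have h3 : (cubicForm W u).c 3 = u := by simp [cubicForm, Quartic.c_mk]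
  rw [h3, mul_ne_zero_iff, mul_ne_zero_iff]
  have := pow_ne_zero 2 h4
  have := pow_ne_zero 2 (div_ne_zero h4 hu)
  tauto

/-- The Weierstrass equation with given `a₁`, `a₃` whose quartic form (with a root at infinity)
is `f`. -/
noncomputable def ofCubicForm (a₁ a₃ : F) (f : Quartic F) : WeierstrassCurve F where
  a₁ := a₁
  a₂ := (f.c 2 - a₁ ^ 2) / 4
  a₃ := a₃
  a₄ := (f.c 1 * f.c 3 / 8 - a₁ * a₃) / 2
  a₆ := (f.c 0 * f.c 3 ^ 2 / 16 - a₃ ^ 2) / 4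

theorem cubicForm_ofCubicForm (a₁ a₃ : F) {f : Quartic F} (h4 : f.c 4 = 0) (h3 : f.c 3 ≠ 0) :
    cubicForm (ofCubicForm a₁ a₃ f) (f.c 3) = f := by
  have h4' := four_ne_zero_of_two h2
  have h8 : (8 : F) ≠ 0 := by
    have := mul_ne_zero h2 h4'
    norm_num at this
    exact this
  have h16 : (16 : F) ≠ 0 := by
    have := mul_ne_zero h2 h8
    norm_num at this
    exact this
  refine Quartic.ext_c fun k => ?_
  rw [cubicForm, Quartic.c_mk]
  fin_cases k <;> simp [WeierstrassCurve.b₂, WeierstrassCurve.b₄, WeierstrassCurve.b₆, ofCubicForm,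
    h4] <;> field_simp <;> ring

theorem ofCubicForm_cubicForm (W : WeierstrassCurve F) {u : F} (hu : u ≠ 0) :
    ofCubicForm W.a₁ W.a₃ (cubicForm W u) = W := by
  have h4' := four_ne_zero_of_two h2
  have h8 : (8 : F) ≠ 0 := by
    have := mul_ne_zero h2 h4'
    norm_num at this
    exact this
  have h16 : (16 : F) ≠ 0 := by
    have := mul_ne_zero h2 h8
    norm_num at this
    exact this
  ext <;> simp [WeierstrassCurve.b₂, WeierstrassCurve.b₄, WeierstrassCurve.b₆, ofCubicForm,
    cubicForm, Quartic.c_mk] <;> field_simp <;> ring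

/-- Weierstrass equations of elliptic curves and forms with distinct roots, one of which is at
infinity. -/
noncomputable def cubicFormEquiv (R : ℕ → ℕ → Prop) :
    {E : EllipticCurve F // R (sqCount (psi E.1)) (rootCount (psi E.1))} × Fˣ ≃
      (F × F) × {f : Quartic F // f.HasDistinctRoots ∧ f.c 4 = 0 ∧
        R (sqCount f.aff) (rootCount f.aff)} where
  toFun p := ((p.1.1.1.a₁, p.1.1.1.a₃), ⟨cubicForm p.1.1.1 p.2,
    (cubicForm_hasDistinctRoots_iff h2 _ p.2.ne_zero).2 (isElliptic_iff_Δ_ne_zero.1 p.1.1.2),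
    by simp [cubicForm, Quartic.c_mk], by
      rw [sqCount_cubicForm h2 _ p.2.ne_zero, rootCount_cubicForm h2 _ p.2.ne_zero]
      exact p.1.2⟩)
  invFun p :=
    have h3 : p.2.1.c 3 ≠ 0 := ((Quartic.hasDistinctRoots_iff_of_c4_eq_zero p.2.2.2.1).1 p.2.2.1).1
    have e := cubicForm_ofCubicForm h2 p.1.1 p.1.2 p.2.2.2.1 h3
    (⟨⟨ofCubicForm p.1.1 p.1.2 p.2.1, isElliptic_iff_Δ_ne_zero.2 <|
      (cubicForm_hasDistinctRoots_iff h2 _ h3).1 (by rw [e]; exact p.2.2.1)⟩, by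
        have h := p.2.2.2.2
        rw [← e, sqCount_cubicForm h2 _ h3, rootCount_cubicForm h2 _ h3] at h
        exact h⟩, Units.mk0 _ h3)
  left_inv p := by
    refine Prod.ext (Subtype.ext (Subtype.ext ?_)) (Units.ext ?_)
    · exact ofCubicForm_cubicForm h2 _ p.2.ne_zero
    · simp [cubicForm, Quartic.c_mk]
  right_inv p := by
    have h3 : p.2.1.c 3 ≠ 0 := ((Quartic.hasDistinctRoots_iff_of_c4_eq_zero p.2.2.2.1).1 p.2.2.1).1
    exact Prod.ext rfl (Subtype.ext (cubicForm_ofCubicForm h2 p.1.1 p.1.2 p.2.2.2.1 h3))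

/-- The curve of a form with a root at infinity has a rational point there, and so is an elliptic
curve. The equation is determined by the form together with `a₁` and `a₃`, the form by the
equation together with its coefficient of `x³ y`. -/
theorem card_forms_root_at_infinity [Fintype F] (R : ℕ → ℕ → Prop) :
    Nat.card {E : EllipticCurve F // R (sqCount (psi E.1)) (rootCount (psi E.1))} *
      (Fintype.card F - 1) = Fintype.card F ^ 2 *
      Nat.card {f : Quartic F // f.HasDistinctRoots ∧ f.c 4 = 0 ∧
        R (sqCount f.aff) (rootCount f.aff)} := by
  classical
  have h := Nat.card_congr (cubicFormEquiv h2 R)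
  rwa [Nat.card_prod, Nat.card_prod, Nat.card_prod, Nat.card_eq_fintype_card (α := Fˣ),
    Nat.card_eq_fintype_card (α := F), Fintype.card_units, ← pow_two] at h

end CubicForms

/-! ### Monic forms and curves with a marked point -/

section MonicForms

variable {F : Type*} [Field F] (h2 : (2 : F) ≠ 0)

/-- The Weierstrass equation with `a₆ = 0` whose monic quartic form is `f`. -/
noncomputable def ofMonicForm (f : Quartic F) : WeierstrassCurve F where
  a₁ := f.c 3 / 2
  a₂ := ((f.c 3 / 2) ^ 2 - f.c 2) / 2
  a₃ := (f.c 1 + 2 * (f.c 3 / 2) * (((f.c 3 / 2) ^ 2 - f.c 2) / 2)) / 4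
  a₄ := ((((f.c 3 / 2) ^ 2 - f.c 2) / 2) ^ 2 - f.c 0) / 4
  a₆ := 0

include h2

theorem monicForm_ofMonicForm {f : Quartic F} (h : f.c 4 = 1) : monicForm (ofMonicForm f) = f := by
  have h4 := four_ne_zero_of_two h2
  refine Quartic.ext_c fun k => ?_
  rw [monicForm, Quartic.c_mk]
  fin_cases k <;> simp [ofMonicForm, h] <;> field_simp <;> ring

theorem ofMonicForm_monicForm {W : WeierstrassCurve F} (h6 : W.a₆ = 0) :
    ofMonicForm (monicForm W) = W := by
  have h4 := four_ne_zero_of_two h2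
  ext <;> simp [ofMonicForm, monicForm, Quartic.c_mk, h6] <;> field_simp <;> ring

/-- The lines through `(0, 0)`, with slope `m`, meet the curve in two further points, whose
`x`-coordinates are the roots of a quadratic polynomial with discriminant `f(m, 1)`. The curve has
one more affine point than the double cover of the line of slopes. -/
theorem sqCount_psi_eq_of_a₆_eq_zero [Finite F] {W : WeierstrassCurve F} (hW : W.IsElliptic)
    (h6 : W.a₆ = 0) : sqCount (psi W) = sqCount (monicForm W).aff + 1 := by
  have hns : W.a₃ ≠ 0 ∨ W.a₄ ≠ 0 :=
    (WeierstrassCurve.Affine.nonsingular_zero.1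
      (WeierstrassCurve.Affine.equation_iff_nonsingular.1
        (WeierstrassCurve.Affine.equation_zero.2 h6))).2
  -- the point `(0, 0)` and, for a slope `m`, the inverse of a point `(x, m x)`
  let x : F × F → F := fun p => (p.2 + p.1 ^ 2 + W.a₁ * p.1 - W.a₂) / 2
  have hx : ∀ p : F × F, p.2 ^ 2 = (monicForm W).aff p.1 ↔
      x p ^ 2 + (W.a₂ - p.1 ^ 2 - W.a₁ * p.1) * x p + (W.a₄ - W.a₃ * p.1) = 0 := by
    intro p
    have h : p.2 = 2 * x p - (p.1 ^ 2 + W.a₁ * p.1 - W.a₂) := by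
      simp only [x]
      field_simp
      ring
    rw [monicForm_aff, h]
    constructor
    · intro h
      refine mul_left_cancel₀ (four_ne_zero_of_two h2) ?_
      linear_combination h
    · intro h
      linear_combination 4 * h
  let g : Option {p : F × F // p.2 ^ 2 = (monicForm W).aff p.1} →
      {p : F × F // W.toAffine.Equation p.1 p.2} := fun o => match o with
    | none => ⟨(0, 0), WeierstrassCurve.Affine.equation_zero.2 h6⟩
    | some p => ⟨(x p.1, -(p.1.1 + W.a₁) * x p.1 - W.a₃), by
        have h := (hx p.1).1 p.2
        rw [WeierstrassCurve.Affine.equation_iff, h6]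
        linear_combination -x p.1 * h⟩
  have hg : Function.Bijective g := by
    constructor
    · rintro (_ | ⟨p, hp⟩) (_ | ⟨p', hp'⟩) h
      · rfl
      · exfalso
        have h := congrArg Subtype.val h
        have h0 : 0 = x p' := congrArg Prod.fst h
        have h1 : 0 = -(p'.1 + W.a₁) * x p' - W.a₃ := congrArg Prod.snd h
        rw [hx, ← h0] at hp'
        rw [← h0] at h1
        have h3 : W.a₃ = 0 := by linear_combination h1
        rw [h3] at hp' hns
        exact hns.elim (fun h => h rfl) fun h => h (by linear_combination hp')
      · exfalso
        have h := congrArg Subtype.val h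
        have h0 : x p = 0 := congrArg Prod.fst h
        have h1 : -(p.1 + W.a₁) * x p - W.a₃ = 0 := congrArg Prod.snd h
        rw [hx, h0] at hp
        rw [h0] at h1
        have h3 : W.a₃ = 0 := by linear_combination -h1
        rw [h3] at hp hns
        exact hns.elim (fun h => h rfl) fun h => h (by linear_combination hp)
      · have h := congrArg Subtype.val h
        have h0 : x p = x p' := congrArg Prod.fst h
        have h1 : -(p.1 + W.a₁) * x p - W.a₃ = -(p'.1 + W.a₁) * x p' - W.a₃ := congrArg Prod.snd h
        have hm : p.1 = p'.1 := by
          by_cases hx0 : x p = 0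
          · rw [hx, hx0] at hp
            rw [hx, ← h0, hx0] at hp'
            have h3 : W.a₃ ≠ 0 := by
              intro h3
              rw [h3] at hp hns
              exact hns.elim (fun h => h rfl) fun h => h (by linear_combination hp)
            refine mul_left_cancel₀ h3 ?_
            linear_combination hp' - hp
          · refine mul_right_cancel₀ hx0 ?_
            rw [← h0] at h1
            linear_combination -h1
        have hw : p.2 = p'.2 := by
          simp only [x, div_left_inj' h2] at h0
          rw [hm] at h0
          linear_combination h0
        rw [Option.some_inj]
        exact Subtype.ext (Prod.ext hm hw)
    · have key : ∀ m X : F, X ^ 2 + (W.a₂ - m ^ 2 - W.a₁ * m) * X + (W.a₄ - W.a₃ * m) = 0 →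
          ∃ p, (g p).1 = (X, -(m + W.a₁) * X - W.a₃) := by
        intro m X h
        have e : x (m, 2 * X - (m ^ 2 + W.a₁ * m - W.a₂)) = X := by
          simp only [x]
          field_simp
          ring
        refine ⟨some ⟨(m, 2 * X - (m ^ 2 + W.a₁ * m - W.a₂)), (hx _).2 ?_⟩, ?_⟩
        · rw [e]
          exact h
        · change (x (m, 2 * X - (m ^ 2 + W.a₁ * m - W.a₂)),
            -(m + W.a₁) * x (m, 2 * X - (m ^ 2 + W.a₁ * m - W.a₂)) - W.a₃) = _
          rw [e]
      rintro ⟨⟨X, Y⟩, h⟩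
      simp only [WeierstrassCurve.Affine.equation_iff, h6] at h
      by_cases hX : X = 0
      · subst hX
        by_cases hY : Y = 0
        · subst hY
          exact ⟨none, rfl⟩
        · have hY' : Y = -W.a₃ := by
            refine mul_left_cancel₀ hY ?_
            linear_combination h
          have h3 : W.a₃ ≠ 0 := fun h3 => hY (by rw [hY', h3, neg_zero])
          obtain ⟨p, hp⟩ := key (W.a₄ / W.a₃) 0 (by field_simp; ring)
          exact ⟨p, Subtype.ext (hp.trans (Prod.ext rfl (by simp [hY'])))⟩
      · obtain ⟨p, hp⟩ := key (-(Y + W.a₃) / X - W.a₁) X (by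
          field_simp
          linear_combination -h)
        refine ⟨p, Subtype.ext (hp.trans ?_)⟩
        congr 1
        field_simp
        ring
  rw [← card_equation h2, ← Nat.card_congr (Equiv.ofBijective g hg), sqCount]
  exact Finite.card_option

/-- Elliptic curves with marked point `(0, 0)` and monic forms with distinct roots. -/
noncomputable def monicFormEquiv [Finite F] (R : ℕ → Prop) :
    {E : EllipticCurve F // E.1.a₆ = 0 ∧ R (sqCount (psi E.1))} ≃
      {f : Quartic F // f.HasDistinctRoots ∧ f.c 4 = 1 ∧ R (sqCount f.aff + 1)} where
  toFun E := ⟨monicForm E.1.1,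
    (monicForm_hasDistinctRoots_iff h2 E.2.1).2 (isElliptic_iff_Δ_ne_zero.1 E.1.2),
    by simp [monicForm, Quartic.c_mk], by
      rw [← sqCount_psi_eq_of_a₆_eq_zero h2 E.1.2 E.2.1]
      exact E.2.2⟩
  invFun f :=
    have e := monicForm_ofMonicForm h2 f.2.2.1
    have hE : (ofMonicForm f.1).IsElliptic := isElliptic_iff_Δ_ne_zero.2 <|
      (monicForm_hasDistinctRoots_iff h2 rfl).1 (by rw [e]; exact f.2.1)
    ⟨⟨ofMonicForm f.1, hE⟩, rfl, by
      rw [sqCount_psi_eq_of_a₆_eq_zero h2 hE rfl, e]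
      exact f.2.2.2⟩
  left_inv E := Subtype.ext (Subtype.ext (ofMonicForm_monicForm h2 E.2.1))
  right_inv f := Subtype.ext (monicForm_ofMonicForm h2 f.2.2.1)

/-- Moving a rational point to `(0, 0)`. -/
noncomputable def translationEquiv (R : ℕ → Prop) :
    (Σ E : {E : EllipticCurve F // R (sqCount (psi E.1))},
      {p : F × F // E.1.1.toAffine.Equation p.1 p.2}) ≃
      (F × F) × {E : EllipticCurve F // E.1.a₆ = 0 ∧ R (sqCount (psi E.1))} where
  toFun P :=
    have := P.1.1.2
    (P.2.1, ⟨⟨WeierstrassCurve.VariableChange.mk 1 P.2.1.1 0 P.2.1.2 • P.1.1.1, inferInstance⟩,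
      WeierstrassCurve.Affine.equation_zero.1
        ((WeierstrassCurve.Affine.equation_iff_variableChange _ _).1 P.2.2), by
        rw [← sqCount_psi_variableChange]
        exact P.1.2⟩)
  invFun P :=
    have := P.2.1.2
    ⟨⟨⟨(WeierstrassCurve.VariableChange.mk 1 P.1.1 0 P.1.2)⁻¹ • P.2.1.1, inferInstance⟩, by
      rw [← sqCount_psi_variableChange]
      exact P.2.2.2⟩, P.1, (WeierstrassCurve.Affine.equation_iff_variableChange _ _).2 <| by
        rw [smul_inv_smul]
        exact WeierstrassCurve.Affine.equation_zero.2 P.2.2.1⟩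
  left_inv P := by
    obtain ⟨⟨⟨W, hW⟩, hR⟩, p, hp⟩ := P
    have e : (WeierstrassCurve.VariableChange.mk 1 p.1 0 p.2)⁻¹ •
        WeierstrassCurve.VariableChange.mk 1 p.1 0 p.2 • W = W := inv_smul_smul _ _
    refine Sigma.ext (Subtype.ext (Subtype.ext e)) ?_
    simp only
    rw [Subtype.heq_iff_coe_eq]
    intro _
    rw [e]
  right_inv P := Prod.ext rfl (Subtype.ext (Subtype.ext (smul_inv_smul _ _)))

/-- The curve of a monic form has two rational points at infinity: monic forms correspond to
elliptic curves with a second rational point, which may be any of the affine points. -/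
theorem card_monic_forms [Fintype F] (n : ℕ) :
    n * Nat.card {E : EllipticCurve F // sqCount (psi E.1) = n} = Fintype.card F ^ 2 *
      Nat.card {f : Quartic F // f.HasDistinctRoots ∧ f.c 4 = 1 ∧ sqCount f.aff + 1 = n} := by
  classical
  have := Fintype.ofFinite {E : EllipticCurve F // sqCount (psi E.1) = n}
  have h := Nat.card_congr (translationEquiv (F := F) (fun k => k = n))
  rw [Nat.card_prod, Nat.card_congr (monicFormEquiv h2 (fun k => k = n)), Nat.card_prod,
    Nat.card_eq_fintype_card (α := F), ← pow_two, Nat.card_sigma] at h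
  rw [← h, Finset.sum_congr rfl (g := fun _ => n), Finset.sum_const, Finset.card_univ,
    Nat.card_eq_fintype_card, smul_eq_mul, mul_comm]
  intro E _
  rw [card_equation h2, E.2]

end MonicForms

end

/-! ### Scaling a form -/

section Scaling

variable {F : Type*} [Field F]

theorem Quartic.val_const_smul (c : F) (f : Quartic F) (v : Fin 2 → F) :
    (c • f).val v = c * f.val v := by
  rw [Quartic.val, Submodule.coe_smul, MvPolynomial.smul_eval]
  rfl

theorem Quartic.c_smul (c : F) (f : Quartic F) (k : Fin 5) : (c • f).c k = c * f.c k := by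
  change ((c • f : Quartic F) : MvPolynomial (Fin 2) F).coeff _ = _
  rw [Submodule.coe_smul, MvPolynomial.coeff_smul]
  rfl

theorem Quartic.hasDistinctRoots_smul {c : F} (hc : c ≠ 0) (f : Quartic F) :
    (c • f).HasDistinctRoots ↔ f.HasDistinctRoots := by
  have : (c • f).roots (AlgebraicClosure F) = f.roots (AlgebraicClosure F) := by
    ext P
    change MvPolynomial.aeval P.rep ((c • f : Quartic F) : MvPolynomial (Fin 2) F) = 0 ↔
      MvPolynomial.aeval P.rep (f : MvPolynomial (Fin 2) F) = 0
    rw [Submodule.coe_smul, map_smul, smul_eq_zero_iff_right hc]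
  rw [Quartic.HasDistinctRoots, this]
  rfl

theorem ncard_curvePoints_smul [Fintype F] {c : F} (hc : c ≠ 0) (f : Quartic F) :
    (c ^ 2 • f).curvePoints.ncard = f.curvePoints.ncard := by
  simp_rw [ncard_curvePoints, projSum, Quartic.val_const_smul, card_sqrts_mul hc]

/-- A quadratic twist: the fibres of `f` and of `ν f` over a point of the line have two points in
total. -/
theorem ncard_curvePoints_add_twist [Fintype F] (hF : ringChar F ≠ 2) {ν : F}
    (hν : ¬ IsSquare ν) (f : Quartic F) :
    f.curvePoints.ncard + (ν • f).curvePoints.ncard = 2 * (Fintype.card F + 1) := by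
  classical
  have h0 : ν ≠ 0 := fun h => hν (h ▸ IsSquare.zero)
  have hq : quadraticChar F ν = -1 := quadraticChar_neg_one_iff_not_isSquare.2 hν
  rw [ncard_curvePoints, ncard_curvePoints, projSum, projSum, ← Finset.sum_add_distrib,
    Finset.sum_congr rfl (g := fun _ => 2), Finset.sum_const, Finset.card_univ, card_proj,
    smul_eq_mul, mul_comm]
  intro P _
  rw [Quartic.val_const_smul, card_sqrts hF, card_sqrts hF, map_mul, hq]
  by_cases ha : f.val P.rep = 0
  · simp [ha]
  · rcases quadraticChar_dichotomy ha with h | h <;> simp [ha, h, h0]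

/-- `j` and `k` are the numbers of points where `f` takes nonzero square values and nonsquare
values. -/
theorem exists_ncard_eq [Fintype F] (hF : ringChar F ≠ 2) (f : Quartic F) :
    ∃ j k : ℕ, (f.roots F).ncard + j + k = Fintype.card F + 1 ∧
      f.curvePoints.ncard = (f.roots F).ncard + 2 * j := by
  classical
  refine ⟨(Finset.univ.filter fun P : Projectivization F (Fin 2 → F) =>
    quadraticChar F (f.val P.rep) = 1).card, (Finset.univ.filter fun P : Projectivization F
      (Fin 2 → F) => quadraticChar F (f.val P.rep) = -1).card, ?_, ?_⟩
  · rw [ncard_roots, projSum, Finset.card_filter, Finset.card_filter, ← card_proj,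
      ← Finset.card_univ, Finset.card_eq_sum_ones, ← Finset.sum_add_distrib,
      ← Finset.sum_add_distrib]
    refine Finset.sum_congr rfl fun P _ => ?_
    by_cases ha : f.val P.rep = 0
    · simp [ha]
    · rcases quadraticChar_dichotomy ha with h | h <;> simp [ha, h]
  · rw [ncard_roots, ncard_curvePoints, projSum, projSum, Finset.card_filter, Finset.mul_sum,
      ← Finset.sum_add_distrib]
    exact Finset.sum_congr rfl fun P _ => card_sqrts hF _

end Scaling

/-! ### Two-torsion and parity -/

section TwoTorsionCount

variable {F : Type*} [Field F]

/-- A cubic polynomial with two rational roots has a third one, and the roots are distinct by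
nonsingularity. -/
theorem rootCount_psi [Finite F] (h2 : (2 : F) ≠ 0) (W : WeierstrassCurve F) (hW : W.IsElliptic) :
    rootCount (psi W) = 0 ∨ rootCount (psi W) = 1 ∨ rootCount (psi W) = 3 := by
  classical
  have := Fintype.ofFinite F
  have h4 := four_ne_zero_of_two h2
  set s : Finset F := Finset.univ.filter fun x => psi W x = 0 with hs
  have hcard : rootCount (psi W) = s.card := by
    rw [rootCount, Nat.card_eq_fintype_card, Fintype.card_subtype]
  have hmem : ∀ x, x ∈ s ↔ psi W x = 0 := fun x => by simp [hs]
  rw [hcard]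
  rcases Nat.lt_or_ge 1 s.card with h1 | h1
  swap
  · omega
  obtain ⟨a, ha, b, hb, hab⟩ := Finset.one_lt_card.1 h1
  rw [hmem] at ha hb
  -- the third root
  obtain ⟨c, hc⟩ : ∃ c, W.b₂ = -4 * (a + b + c) :=
    ⟨-W.b₂ / 4 - a - b, by field_simp; ring⟩
  rw [psi] at ha hb
  have hb4 : 2 * W.b₄ = 4 * (a * b + b * c + c * a) := by
    refine mul_left_cancel₀ (sub_ne_zero.2 hab) ?_
    linear_combination ha - hb - (a ^ 2 - b ^ 2) * hc
  have hb6 : W.b₆ = -4 * (a * b * c) := by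
    linear_combination ha - a ^ 2 * hc - a * hb4
  have hdisc : ((4 : F) ^ 2 * ((a - b) * (a - c) * (b - c))) ^ 2 = 4 ^ 2 * W.Δ := by
    have h := W.twoTorsionPolynomial_discr
    have e : (4 : F) ^ 2 * W.Δ = W.twoTorsionPolynomial.discr := by rw [h]; norm_num
    rw [e, WeierstrassCurve.twoTorsionPolynomial, hb4, hb6, hc, Cubic.discr]
    ring
  have hprod : (a - b) * (a - c) * (b - c) ≠ 0 := by
    intro h0
    rw [h0, mul_zero, zero_pow two_ne_zero] at hdisc
    exact mul_ne_zero (pow_ne_zero 2 h4) (isElliptic_iff_Δ_ne_zero.1 hW) hdisc.symm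
  have hac : a ≠ c := fun h => hprod (by rw [h]; ring)
  have hbc : b ≠ c := fun h => hprod (by rw [h]; ring)
  have hs3 : s = {a, b, c} := by
    ext x
    have : psi W x = 4 * ((x - a) * (x - b) * (x - c)) := by
      rw [psi, hb4, hb6, hc]
      ring
    rw [hmem, this]
    simp only [mul_eq_zero, h4, sub_eq_zero, Finset.mem_insert, Finset.mem_singleton]
    tauto
  rw [hs3, Finset.card_eq_three.2 ⟨a, b, c, hab, hac, hbc, rfl⟩]
  simp

theorem even_sqCount_iff [Fintype F] (hF : ringChar F ≠ 2) (f : F → F) :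
    Even (sqCount f) ↔ Even (rootCount f) := by
  classical
  have : rootCount f = (Finset.univ.filter fun x => f x = 0).card := by
    rw [rootCount, Nat.card_eq_fintype_card, Fintype.card_subtype]
  rw [sqCount_eq hF, this, Nat.even_add]
  simp

end TwoTorsionCount

/-! ### The numbers of forms -/

section Counting

variable {F : Type*} [Field F] [Fintype F]

noncomputable instance : Fintype (Quartic F) := Fintype.ofFinite _

variable (F) in
open Classical in
/-- The forms with distinct roots for which the curve `w² = f(x, y)` has `M` rational points. -/
noncomputable def forms (M : ℕ) : Finset (Quartic F) :=
  {f | f.HasDistinctRoots ∧ f.curvePoints.ncard = M}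

theorem mem_forms {M : ℕ} {f : Quartic F} :
    f ∈ forms F M ↔ f.HasDistinctRoots ∧ f.curvePoints.ncard = M := by
  simp [forms]

variable (F) in
/-- The number of Weierstrass equations of elliptic curves with `n` affine points. -/
noncomputable def curveCount (n : ℕ) : ℕ := Nat.card {E : EllipticCurve F // sqCount (psi E.1) = n}

variable (F) in
/-- The number of Weierstrass equations of elliptic curves with `n` affine points and `r` points of
order two. -/
noncomputable def curveCountTorsion (n r : ℕ) : ℕ :=
  Nat.card {E : EllipticCurve F // sqCount (psi E.1) = n ∧ rootCount (psi E.1) = r}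

variable (hF : ringChar F ≠ 2)

open Classical in
/-- A form whose leading coefficient is a nonzero square is a multiple of a monic form by that
square. -/
theorem sum_sqrts_forms (M : ℕ) :
    ∑ f ∈ forms F M, Nat.card {w : F // w ^ 2 = f.c 4} =
      ((forms F M).filter fun f => f.c 4 = 0).card +
        (Fintype.card F - 1) * ((forms F M).filter fun f => f.c 4 = 1).card := by
  have h : ∀ f : Quartic F, Nat.card {w : F // w ^ 2 = f.c 4} =
      ∑ w : F, if f.c 4 = w ^ 2 then 1 else 0 := fun f => by
    rw [Nat.card_eq_fintype_card, Fintype.card_subtype, Finset.card_filter]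
    simp_rw [eq_comm]
  simp_rw [h]
  rw [Finset.sum_comm, ← Finset.add_sum_erase _ _ (Finset.mem_univ 0)]
  simp_rw [← Finset.card_filter]
  congr 1
  · simp
  · rw [Finset.sum_congr rfl (g := fun _ => ((forms F M).filter fun f => f.c 4 = 1).card),
      Finset.sum_const, Finset.card_erase_of_mem (Finset.mem_univ _), Finset.card_univ, smul_eq_mul]
    intro w hw
    have hw : w ≠ 0 := Finset.ne_of_mem_erase hw
    refine Finset.card_bij' (fun f _ => w⁻¹ ^ 2 • f) (fun f _ => w ^ 2 • f) ?_ ?_ ?_ ?_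
    · intro f hf
      rw [Finset.mem_filter, mem_forms] at hf ⊢
      rw [ncard_curvePoints_smul (inv_ne_zero hw),
        Quartic.hasDistinctRoots_smul (pow_ne_zero 2 (inv_ne_zero hw)), Quartic.c_smul, hf.2]
      exact ⟨hf.1, by field_simp⟩
    · intro f hf
      rw [Finset.mem_filter, mem_forms] at hf ⊢
      rw [ncard_curvePoints_smul hw,
        Quartic.hasDistinctRoots_smul (pow_ne_zero 2 hw), Quartic.c_smul, hf.2]
      exact ⟨hf.1, by ring⟩
    · intro f _
      simp only [smul_smul, ← mul_pow, mul_inv_cancel₀ hw, one_pow, one_smul]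
    · intro f _
      simp only [smul_smul, ← mul_pow, inv_mul_cancel₀ hw, one_pow, one_smul]

include hF

open Classical in
theorem card_filter_c4_eq_zero (n : ℕ) :
    Fintype.card F ^ 2 * ((forms F (n + 1)).filter fun f => f.c 4 = 0).card =
      curveCount F n * (Fintype.card F - 1) := by
  have h2 : (2 : F) ≠ 0 := Ring.two_ne_zero hF
  rw [curveCount, card_forms_root_at_infinity h2 (fun k _ => k = n)]
  congr 1
  rw [Nat.card_eq_fintype_card, Fintype.card_subtype]
  congr 1
  ext f
  rw [Finset.mem_filter, mem_forms, ncard_curvePoints_eq]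
  simp only [Finset.mem_filter, Finset.mem_univ, true_and]
  rw [and_assoc, and_comm (a := _ = n + 1)]
  refine and_congr_right fun _ => and_congr_right fun h => ?_
  rw [h, card_sqrts hF]
  simp
  omega

open Classical in
theorem card_filter_c4_eq_one (n : ℕ) :
    Fintype.card F ^ 2 * ((forms F (n + 1)).filter fun f => f.c 4 = 1).card =
      n * curveCount F n := by
  have h2 : (2 : F) ≠ 0 := Ring.two_ne_zero hF
  rw [curveCount, card_monic_forms h2 n]
  congr 1
  rw [Nat.card_eq_fintype_card, Fintype.card_subtype]
  congr 1
  ext f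
  rw [Finset.mem_filter, mem_forms, ncard_curvePoints_eq]
  simp only [Finset.mem_filter, Finset.mem_univ, true_and]
  rw [and_assoc, and_comm (a := _ = n + 1)]
  refine and_congr_right fun _ => and_congr_right fun h => ?_
  rw [h, card_sqrts hF]
  simp
  omega

/-- Double counting of the points on the curves `w² = f(x, y)`: on the curve of a form there are
`n + 1` of them, and the points over the point at infinity of the line are counted by the forms
that vanish there and by the monic forms. -/
theorem card_forms (n : ℕ) : Fintype.card F ^ 2 * (forms F (n + 1)).card =
    (Fintype.card F + 1) * (Fintype.card F - 1) * curveCount F n := by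
  classical
  have h := sum_projSum (φ := fun a : F => Nat.card {w : F // w ^ 2 = a}) (forms F (n + 1))
    fun g f hf => by
      rw [mem_forms] at hf ⊢
      rwa [Quartic.hasDistinctRoots_subst, ncard_curvePoints_subst]
  rw [Finset.sum_congr rfl (g := fun _ => n + 1) (fun f hf => by
    rw [← ncard_curvePoints, (mem_forms.1 hf).2]), Finset.sum_const, smul_eq_mul,
    sum_sqrts_forms] at h
  have h0 := card_filter_c4_eq_zero hF n
  have h1 := card_filter_c4_eq_one hF n
  set N0 := ((forms F (n + 1)).filter fun f => f.c 4 = 0).card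
  set N1 := ((forms F (n + 1)).filter fun f => f.c 4 = 1).card
  set q := Fintype.card F
  refine Nat.eq_of_mul_eq_mul_right (Nat.succ_pos n) ?_
  calc q ^ 2 * (forms F (n + 1)).card * (n + 1) = q ^ 2 * ((forms F (n + 1)).card * (n + 1)) := by
        ring
    _ = (q + 1) * (q ^ 2 * N0 + (q - 1) * (q ^ 2 * N1)) := by rw [h]; ring
    _ = _ := by rw [h0, h1, Nat.succ_eq_add_one]; ring

open Classical in
/-- Double counting of the rational roots. -/
theorem card_forms_roots (n r : ℕ) :
    Fintype.card F ^ 2 * ((r + 1) *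
      ((forms F (n + 1)).filter fun f => (f.roots F).ncard = r + 1).card) =
    (Fintype.card F + 1) * (Fintype.card F - 1) * curveCountTorsion F n r := by
  have h2 : (2 : F) ≠ 0 := Ring.two_ne_zero hF
  have h := sum_projSum (φ := fun a : F => if a = 0 then 1 else 0)
    ((forms F (n + 1)).filter fun f => (f.roots F).ncard = r + 1) fun g f hf => by
      rw [Finset.mem_filter, mem_forms] at hf ⊢
      rwa [Quartic.hasDistinctRoots_subst, ncard_curvePoints_subst, ncard_roots_subst]
  rw [Finset.sum_congr rfl (g := fun _ => r + 1) (fun f hf => by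
    rw [← ncard_roots, (Finset.mem_filter.1 hf).2]), Finset.sum_const, smul_eq_mul,
    ← Finset.card_filter] at h
  have h0 : Fintype.card F ^ 2 * (((forms F (n + 1)).filter fun f =>
      (f.roots F).ncard = r + 1).filter fun f => f.c 4 = 0).card =
      curveCountTorsion F n r * (Fintype.card F - 1) := by
    rw [curveCountTorsion, card_forms_root_at_infinity h2 (fun k l => k = n ∧ l = r)]
    congr 1
    rw [Nat.card_eq_fintype_card, Fintype.card_subtype]
    congr 1
    ext f
    rw [Finset.mem_filter, Finset.mem_filter, mem_forms, ncard_curvePoints_eq, ncard_roots_eq]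
    simp only [Finset.mem_filter, Finset.mem_univ, true_and]
    rw [and_assoc, and_assoc]
    refine and_congr_right fun _ => ?_
    by_cases h : f.c 4 = 0
    · rw [h, card_sqrts hF]
      simp
      omega
    · simp [h]
  rw [mul_comm (r + 1), h, mul_left_comm, h0]
  ring

/-- Hasse's bound for the curves of forms. It excludes curves without rational points, because a
quadratic twist of such a curve would be an elliptic curve with `2 q + 2` points. -/
theorem sq_sub_le_of_forms_nonempty {M : ℕ} (h : (forms F M).Nonempty) :
    1 ≤ M ∧ ((Fintype.card F : ℤ) + 1 - M) ^ 2 ≤ 4 * Fintype.card F := by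
  have hq : 1 < Fintype.card F := Fintype.one_lt_card
  have key : ∀ n, (forms F (n + 1)).Nonempty →
      ((Fintype.card F : ℤ) - n) ^ 2 ≤ 4 * Fintype.card F := by
    intro n hn
    have h := card_forms hF n
    have hpos := hn.card_pos
    have : curveCount F n ≠ 0 := by
      intro h0
      rw [h0, mul_zero] at h
      have : 0 < Fintype.card F ^ 2 * (forms F (n + 1)).card := by positivity
      omega
    obtain ⟨⟨E, hE⟩⟩ := (Nat.card_ne_zero.1 this).1
    have := E.2
    rw [← hE]
    exact sq_sub_sqCount_psi_le hF E.1
  rcases M with _ | n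
  · exfalso
    obtain ⟨f, hf⟩ := h
    obtain ⟨ν, hν⟩ := FiniteField.exists_nonsquare hF
    have h0 : ν ≠ 0 := fun h => hν (h ▸ IsSquare.zero)
    rw [mem_forms] at hf
    have ht := ncard_curvePoints_add_twist hF hν f
    have := key (2 * Fintype.card F + 1) ⟨ν • f, mem_forms.2
      ⟨(Quartic.hasDistinctRoots_smul h0 f).2 hf.1, by omega⟩⟩
    push_cast at this
    have hq' : (1 : ℤ) < Fintype.card F := by exact_mod_cast hq
    nlinarith
  · refine ⟨by omega, ?_⟩
    have := key n h
    push_cast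
    convert this using 2
    ring

end Counting

/-! ### Grouping the forms by trace -/

section Regrouping

variable {F : Type*} [Field F] [Fintype F] (hF : ringChar F ≠ 2)

/-- The monomial of a form: its exponents are the numbers of points of the projective line where
the form takes the value zero, a nonzero square value, a nonsquare value. The last two are expressed
by the numbers of roots and of points on the curve; the divisions are exact. -/
noncomputable def formMono (f : Quartic F) : MvPolynomial (Fin 3) ℚ :=
  mono (f.roots F).ncard (((f.curvePoints.ncard : ℤ) - (f.roots F).ncard) / 2)
    ((2 * (Fintype.card F + 1) - f.curvePoints.ncard - (f.roots F).ncard) / 2)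

variable (F) in
open Classical in
/-- The forms with distinct roots. -/
noncomputable def smoothForms : Finset (Quartic F) := {f | f.HasDistinctRoots}

include hF

theorem smoothQR_eq_sum : smoothQR F = ∑ f ∈ smoothForms F, formMono f := by
  classical
  choose j k hsum hpts using fun f : Quartic F => exists_ncard_eq hF f
  have hmono : ∀ f : Quartic F, formMono f = MvPolynomial.X 0 ^ (f.roots F).ncard *
      MvPolynomial.X 1 ^ j f * MvPolynomial.X 2 ^ k f := by
    intro f
    have h1 := hsum f
    have h2 := hpts f
    rw [formMono, mono, Int.toNat_natCast]
    congr 3 <;> omega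
  have hmaps : ∀ f ∈ smoothForms F, ![(f.roots F).ncard, j f, k f] ∈
      Finset.Nat.antidiagonalTuple 3 (Fintype.card F + 1) := by
    intro f _
    rw [Finset.Nat.mem_antidiagonalTuple, Fin.sum_univ_three]
    exact hsum f
  rw [← Finset.sum_fiberwise_of_maps_to hmaps, smoothQR]
  refine Finset.sum_congr rfl fun e he => ?_
  rw [Finset.Nat.mem_antidiagonalTuple, Fin.sum_univ_three] at he
  have hfilter : ∀ f : Quartic F, ![(f.roots F).ncard, j f, k f] = e ↔
      (f.roots F).ncard = e 0 ∧ f.curvePoints.ncard = e 0 + 2 * e 1 := by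
    intro f
    have h1 := hsum f
    have h2 := hpts f
    constructor
    · rintro rfl
      exact ⟨rfl, h2⟩
    · rintro ⟨h3, h4⟩
      ext i
      fin_cases i <;> simp <;> omega
  have hcount : smoothCount F (e 0) (e 1) =
      ((smoothForms F).filter fun f => ![(f.roots F).ncard, j f, k f] = e).card := by
    rw [smoothCount, ← Set.ncard_coe_finset]
    congr 1
    ext f
    simp [smoothForms, hfilter]
  rw [hcount, Finset.sum_congr rfl (g := fun _ => MvPolynomial.X 0 ^ (e 0) *
      MvPolynomial.X 1 ^ (e 1) * MvPolynomial.X 2 ^ (e 2)), Finset.sum_const, nsmul_eq_mul]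
  · simp [mul_assoc]
  · intro f hf
    rw [hmono, ← (Finset.mem_filter.1 hf).2]
    rfl

theorem smoothQR_eq_sum_traces : smoothQR F =
    ∑ t ∈ traces (Fintype.card F), ∑ f ∈ forms F (Fintype.card F + 1 - t).toNat, formMono f := by
  classical
  have hmem : ∀ f ∈ smoothForms F, 1 ≤ f.curvePoints.ncard ∧
      ((Fintype.card F : ℤ) + 1 - f.curvePoints.ncard) ^ 2 ≤ 4 * Fintype.card F := fun f hf =>
    sq_sub_le_of_forms_nonempty hF ⟨f, mem_forms.2 ⟨by simpa [smoothForms] using hf, rfl⟩⟩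
  rw [smoothQR_eq_sum hF, ← Finset.sum_fiberwise_of_maps_to
    (g := fun f : Quartic F => (Fintype.card F : ℤ) + 1 - f.curvePoints.ncard)
    (t := traces (Fintype.card F)) (fun f hf => mem_traces.2 (hmem f hf).2)]
  refine Finset.sum_congr rfl fun t _ => Finset.sum_congr ?_ fun _ _ => rfl
  ext f
  rw [Finset.mem_filter, mem_forms]
  have hsm : f ∈ smoothForms F ↔ f.HasDistinctRoots := by simp [smoothForms]
  rw [hsm]
  refine and_congr_right fun h => ?_
  have := (hmem f (hsm.2 h)).1
  omega

end Regrouping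

/-! ### The forms of a given trace -/

section FixedTrace

variable {F : Type*} [Field F] [Fintype F] (hF : ringChar F ≠ 2)

/-- The bound `t² ≤ 4 q` implies `t ≤ q`, so that `q - t` is a number of affine points. -/
theorem exists_natCast_eq_of_mem_traces {q : ℕ} {t : ℤ} (hq : 1 < q) (ht : t ∈ traces q) :
    ∃ n : ℕ, (n : ℤ) = q - t := by
  refine ⟨(q - t : ℤ).toNat, Int.toNat_of_nonneg ?_⟩
  rw [mem_traces] at ht
  by_contra! h
  have : (1 : ℤ) < q := by exact_mod_cast hq
  nlinarith

theorem formMono_eq {n i : ℕ} {t : ℤ} (hn : (n : ℤ) = Fintype.card F - t) {f : Quartic F}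
    (hf : f ∈ forms F (n + 1)) (hi : (f.roots F).ncard = i) :
    formMono f = mono i ((Fintype.card F + 1 - i - t) / 2) ((Fintype.card F + 1 - i + t) / 2) := by
  rw [formMono, (mem_forms.1 hf).2, hi]
  congr 2 <;> push_cast <;> omega

include hF

theorem curveCount_eq {n : ℕ} {t : ℤ} (hn : (n : ℤ) = Fintype.card F - t) :
    (curveCount F n : ℚ) =
      weightedCount F t * (((Fintype.card F : ℚ) - 1) * (Fintype.card F : ℚ) ^ 3) := by
  rw [weightedCount_mul (Ring.two_ne_zero hF), ← hn, curveCount]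
  simp_rw [Nat.cast_inj]

theorem curveCountTorsion_three_eq [DecidableEq F] {n : ℕ} {t : ℤ}
    (hn : (n : ℤ) = Fintype.card F - t) :
    (curveCountTorsion F n 3 : ℚ) =
      weightedCountFull F t * (((Fintype.card F : ℚ) - 1) * (Fintype.card F : ℚ) ^ 3) := by
  rw [weightedCountFull_mul (Ring.two_ne_zero hF), ← hn, curveCountTorsion]
  simp_rw [Nat.cast_inj]

/-- By parity, curves with an odd trace have no rational two-torsion. -/
theorem curveCountTorsion_zero_of_even {n : ℕ} (h : Even n) :
    curveCountTorsion F n 0 = curveCount F n := by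
  refine Nat.card_congr (Equiv.subtypeEquivRight fun E => and_iff_left_of_imp fun hE => ?_)
  have h1 := (even_sqCount_iff hF (psi E.1)).1 (hE ▸ h)
  rcases rootCount_psi (Ring.two_ne_zero hF) E.1 E.2 with h0 | h0 | h0
  · exact h0
  all_goals rw [h0] at h1; exact absurd h1 (by decide)

theorem curveCountTorsion_add_of_odd {n : ℕ} (h : Odd n) :
    curveCountTorsion F n 1 + curveCountTorsion F n 3 = curveCount F n := by
  classical
  have := Fintype.ofFinite (EllipticCurve F)
  simp only [curveCountTorsion, curveCount, Nat.card_eq_fintype_card, Fintype.card_subtype]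
  rw [← Finset.card_union_of_disjoint]
  · congr 1
    ext E
    simp only [Finset.mem_union, Finset.mem_filter, Finset.mem_univ, true_and, ← and_or_left]
    refine and_iff_left_of_imp fun hE => ?_
    have h1 := (even_sqCount_iff hF (psi E.1)).not.1 (by rwa [hE, Nat.not_even_iff_odd])
    rcases rootCount_psi (Ring.two_ne_zero hF) E.1 E.2 with h0 | h0
    · rw [h0] at h1
      exact absurd Even.zero h1
    · exact h0
  · rw [Finset.disjoint_filter]
    rintro E - h1 h3
    omega

theorem curveCountTorsion_eq_zero_of_odd {n r : ℕ} (h : Odd n) (h1 : r ≠ 1) (h3 : r ≠ 3) :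
    curveCountTorsion F n r = 0 := by
  have : IsEmpty {E : EllipticCurve F // sqCount (psi E.1) = n ∧ rootCount (psi E.1) = r} := by
    refine ⟨fun ⟨E, hE, hr⟩ => ?_⟩
    have h1 := (even_sqCount_iff hF (psi E.1)).not.1 (by rwa [hE, Nat.not_even_iff_odd])
    rcases rootCount_psi (Ring.two_ne_zero hF) E.1 E.2 with h0 | h0
    · rw [h0] at h1
      exact absurd Even.zero h1
    · omega
  exact Nat.card_of_isEmpty

theorem card_forms_eq {n : ℕ} {t : ℤ} (hn : (n : ℤ) = Fintype.card F - t) :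
    ((forms F (n + 1)).card : ℚ) = ((Fintype.card F : ℚ) - 1) ^ 2 * Fintype.card F *
      (Fintype.card F + 1) * weightedCount F t := by
  have h := congrArg (Nat.cast (R := ℚ)) (card_forms hF n)
  have hq : 1 < Fintype.card F := Fintype.one_lt_card
  push_cast [hq.le] at h
  rw [curveCount_eq hF hn] at h
  have h0 : (Fintype.card F : ℚ) ≠ 0 := by positivity
  refine mul_left_cancel₀ (pow_ne_zero 2 h0) ?_
  rw [h]
  ring

open Classical in
theorem card_forms_roots_eq {n r : ℕ} {w : ℚ} (hw : (curveCountTorsion F n r : ℚ) =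
      w * (((Fintype.card F : ℚ) - 1) * (Fintype.card F : ℚ) ^ 3)) :
    (((forms F (n + 1)).filter fun f => (f.roots F).ncard = r + 1).card : ℚ) =
      ((Fintype.card F : ℚ) - 1) ^ 2 * Fintype.card F * (Fintype.card F + 1) *
        (1 / (r + 1) * w) := by
  have h := congrArg (Nat.cast (R := ℚ)) (card_forms_roots hF n r)
  have hq : 1 < Fintype.card F := Fintype.one_lt_card
  push_cast [hq.le] at h
  rw [hw] at h
  have h0 : (Fintype.card F : ℚ) ≠ 0 := by positivity
  have hr : (r : ℚ) + 1 ≠ 0 := by positivity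
  refine mul_left_cancel₀ (mul_ne_zero (pow_ne_zero 2 h0) hr) ?_
  rw [mul_assoc, h]
  field_simp

theorem sum_formMono_of_odd {t : ℤ} (ht : t ∈ traces (Fintype.card F)) (hodd : Odd t) :
    ∑ f ∈ forms F (Fintype.card F + 1 - t).toNat, formMono f =
      MvPolynomial.C (((Fintype.card F : ℚ) - 1) ^ 2 * Fintype.card F * (Fintype.card F + 1)) *
        (MvPolynomial.C (weightedCount F t) *
          mono 1 ((Fintype.card F - t) / 2) ((Fintype.card F + t) / 2)) := by
  classical
  obtain ⟨n, hn⟩ := exists_natCast_eq_of_mem_traces Fintype.one_lt_card ht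
  have hM : (Fintype.card F + 1 - t : ℤ).toNat = n + 1 := by omega
  have hqodd : Fintype.card F % 2 = 1 := FiniteField.odd_card_of_char_ne_two hF
  have heven : Even n := by
    rw [Int.odd_iff] at hodd
    rw [Nat.even_iff]
    omega
  rw [hM]
  have hcard := card_forms_eq hF hn
  -- all forms have exactly one rational root, by comparison of the numbers of forms
  have hone : (forms F (n + 1)).filter (fun f => (f.roots F).ncard = 0 + 1) = forms F (n + 1) := by
    refine Finset.eq_of_subset_of_card_le (Finset.filter_subset _ _) (le_of_eq ?_)
    have h := card_forms_roots_eq hF (n := n) (r := 0) (w := weightedCount F t) (by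
      rw [curveCountTorsion_zero_of_even hF heven, curveCount_eq hF hn])
    rw [← Nat.cast_inj (R := ℚ), hcard, h]
    simp
  rw [Finset.sum_congr rfl (g := fun _ => mono 1 ((Fintype.card F - t) / 2)
    ((Fintype.card F + t) / 2)), Finset.sum_const, nsmul_eq_mul, ← mul_assoc, ← map_mul, ← hcard,
    map_natCast]
  intro f hf
  rw [← hone, Finset.mem_filter] at hf
  rw [formMono_eq hn hf.1 hf.2]
  congr 2 <;> push_cast <;> ring

theorem sum_formMono_of_even [DecidableEq F] {t : ℤ} (ht : t ∈ traces (Fintype.card F))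
    (heven : Even t) :
    ∑ f ∈ forms F (Fintype.card F + 1 - t).toNat, formMono f =
      MvPolynomial.C (((Fintype.card F : ℚ) - 1) ^ 2 * Fintype.card F * (Fintype.card F + 1)) *
        (MvPolynomial.C (weightedCount F t - weightedCountFull F t) *
          (MvPolynomial.C (1 / 2) * mono 2 ((Fintype.card F - 1 - t) / 2)
              ((Fintype.card F - 1 + t) / 2)
            + MvPolynomial.C (1 / 2) * mono 0 ((Fintype.card F + 1 - t) / 2)
              ((Fintype.card F + 1 + t) / 2))
        + MvPolynomial.C (weightedCountFull F t) *
          (MvPolynomial.C (1 / 4) * mono 4 ((Fintype.card F - 3 - t) / 2)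
              ((Fintype.card F - 3 + t) / 2)
            + MvPolynomial.C (3 / 4) * mono 0 ((Fintype.card F + 1 - t) / 2)
              ((Fintype.card F + 1 + t) / 2))) := by
  classical
  obtain ⟨n, hn⟩ := exists_natCast_eq_of_mem_traces Fintype.one_lt_card ht
  have hM : (Fintype.card F + 1 - t : ℤ).toNat = n + 1 := by omega
  have hqodd : Fintype.card F % 2 = 1 := FiniteField.odd_card_of_char_ne_two hF
  have hodd : Odd n := by
    rw [Int.even_iff] at heven
    rw [Nat.odd_iff]
    omega
  rw [hM]
  set T := forms F (n + 1)
  set N : ℕ → ℕ := fun i => (T.filter fun f => (f.roots F).ncard = i).card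
  set K : ℚ := ((Fintype.card F : ℚ) - 1) ^ 2 * Fintype.card F * (Fintype.card F + 1)
  have hcard : (T.card : ℚ) = K * weightedCount F t := card_forms_eq hF hn
  have h3 := curveCountTorsion_three_eq hF hn
  have hN4 : (N 4 : ℚ) = K * (1 / 4 * weightedCountFull F t) := by
    have h := card_forms_roots_eq hF (r := 3) h3
    norm_num at h
    exact h
  have hN2 : (N 2 : ℚ) = K * (1 / 2 * (weightedCount F t - weightedCountFull F t)) := by
    have h1 := congrArg (Nat.cast (R := ℚ)) (curveCountTorsion_add_of_odd hF hodd)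
    rw [Nat.cast_add, h3, curveCount_eq hF hn] at h1
    have h := card_forms_roots_eq hF (n := n) (r := 1)
      (w := weightedCount F t - weightedCountFull F t) (by rw [sub_mul]; linear_combination h1)
    norm_num at h
    exact h
  -- a form with a rational root gives an elliptic curve with one or three points of order two
  have hmaps : ∀ f ∈ T, (f.roots F).ncard ∈ ({0, 2, 4} : Finset ℕ) := by
    intro f hf
    rcases hr : (f.roots F).ncard with _ | r
    · simp
    by_contra hne
    simp only [Finset.mem_insert, Finset.mem_singleton] at hne
    have h := card_forms_roots_eq hF (n := n) (r := r) (w := 0) (by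
      rw [curveCountTorsion_eq_zero_of_odd hF hodd (by omega) (by omega)]; simp)
    simp only [mul_zero, Nat.cast_eq_zero, Finset.card_eq_zero] at h
    have : f ∈ (∅ : Finset (Quartic F)) := h ▸ Finset.mem_filter.2 ⟨hf, hr⟩
    simp at this
  have hN0 : (N 0 : ℚ) = K * (1 / 2 * (weightedCount F t - weightedCountFull F t) +
      3 / 4 * weightedCountFull F t) := by
    have h := Finset.card_eq_sum_card_fiberwise hmaps
    rw [Finset.sum_insert (by simp), Finset.sum_insert (by simp), Finset.sum_singleton] at h
    change T.card = N 0 + (N 2 + N 4) at h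
    have h := congrArg (Nat.cast (R := ℚ)) h
    push_cast at h
    rw [hcard, hN2, hN4] at h
    linear_combination -h
  have hsum : ∀ i : ℕ, ∑ f ∈ T with (f.roots F).ncard = i, formMono f =
      MvPolynomial.C (N i : ℚ) *
        mono i ((Fintype.card F + 1 - i - t) / 2) ((Fintype.card F + 1 - i + t) / 2) := by
    intro i
    rw [Finset.sum_congr rfl fun f hf =>
      formMono_eq hn (Finset.mem_filter.1 hf).1 (Finset.mem_filter.1 hf).2, Finset.sum_const,
      nsmul_eq_mul, map_natCast]
  have e2 : (Fintype.card F : ℤ) + 1 - 2 = Fintype.card F - 1 := by ring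
  have e4 : (Fintype.card F : ℤ) + 1 - 4 = Fintype.card F - 3 := by ring
  rw [← Finset.sum_fiberwise_of_maps_to hmaps, Finset.sum_insert (by simp),
    Finset.sum_insert (by simp), Finset.sum_singleton, hsum, hsum, hsum, hN0, hN2, hN4]
  simp only [Nat.cast_zero, Nat.cast_ofNat, sub_zero, e2, e4, map_mul, map_add]
  ring

end FixedTrace

end QRW

theorem theorem2p8 {F : Type*} [Field F] [Fintype F] [DecidableEq F] (p v q : ℕ)
    (hp : p.Prime) (hp2 : p ≠ 2) (hq : q = p ^ v) (hF : Fintype.card F = q) :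
    QRW.smoothQR F =
      MvPolynomial.C (((q : ℚ) - 1) ^ 2 * q * (q + 1)) *
        (∑ t ∈ QRW.traces q with Odd t,
            MvPolynomial.C (QRW.weightedCount F t) * QRW.mono 1 ((q - t) / 2) ((q + t) / 2)
          + ∑ t ∈ QRW.traces q with Even t,
            (MvPolynomial.C (QRW.weightedCount F t - QRW.weightedCountFull F t) *
                (MvPolynomial.C (1 / 2) * QRW.mono 2 ((q - 1 - t) / 2) ((q - 1 + t) / 2)
                  + MvPolynomial.C (1 / 2) * QRW.mono 0 ((q + 1 - t) / 2) ((q + 1 + t) / 2))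
              + MvPolynomial.C (QRW.weightedCountFull F t) *
                (MvPolynomial.C (1 / 4) * QRW.mono 4 ((q - 3 - t) / 2) ((q - 3 + t) / 2)
                  + MvPolynomial.C (3 / 4) *
                    QRW.mono 0 ((q + 1 - t) / 2) ((q + 1 + t) / 2)))) := by
  have hchar : ringChar F ≠ 2 := by
    intro h
    have heven := FiniteField.even_card_of_char_two h
    have hodd : Odd (p ^ v) := (hp.odd_of_ne_two hp2).pow
    rw [hF, hq] at heven
    rw [Nat.odd_iff] at hodd
    omega
  subst hF
  rw [QRW.smoothQR_eq_sum_traces hchar,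
    ← Finset.sum_filter_add_sum_filter_not _ (fun t : ℤ => Odd t), mul_add, Finset.mul_sum,
    Finset.mul_sum]
  simp_rw [Int.not_odd_iff_even]
  congr 1
  · refine Finset.sum_congr rfl fun t ht => ?_
    rw [Finset.mem_filter] at ht
    exact QRW.sum_formMono_of_odd hchar ht.1 ht.2
  · refine Finset.sum_congr rfl fun t ht => ?_
    rw [Finset.mem_filter] at ht
    exact QRW.sum_formMono_of_even hchar ht.1 ht.2
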